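/- Let $\mathcal H$ be a complex Hilbert space with an orthonormal basis $\{|n\rangle : n\in\mathbb N\}$, $\mathbb N=\{0,1,2,\dots\}$, let $\mathbb T=\{t\in\mathbb C:|t|=1\}$ with Borel $\sigma$-algebra $\mathcal B(\mathbb T)$ and normalized Haar measure $dt$, and let $U(t)$ be the unitary operator with $U(t)|n\rangle=t^n|n\rangle$. An *observable* is a map $\mathsf E:\mathcal B(\mathbb T)\to\mathcal L(\mathcal H)$ with $0\le \mathsf E(X)\le I$, $\mathsf E(\mathbb T)=I$, which is countably additive in the weak operator topology; it is a *phase observable* if $U(t)\mathsf E(X)U(t)^*=\mathsf E(tX)$ for all $t\in\mathbb T$ and $X\in\mathcal B(\mathbb T)$. A positive semidefinite complex matrix $(c_{m,n})_{m,n\in\mathbb N}$ with $c_{n,n}=1$ for all $n$ is the *phase matrix* of $\mathsf E$ if $\langle m|\mathsf E(X)|n\rangle=c_{m,n}\int_X t^{m-n}\,dt$ for all $m,n\in\mathbb N$ and $X\in\mathcal B(\mathbb T)$. The *canonical phase observable* $\mathsf E_{\mathrm{can}}$ is the phase observable with phase matrix $c_{m,n}=1$ for all $m,n$. A *channel* is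 a linear map $\Phi$ of the trace class of $\mathcal H$ into itself having an adjoint $\Phi^*:\mathcal L(\mathcal H)\to\mathcal L(\mathcal H)$, $\operatorname{tr}(\Phi(T)A)=\operatorname{tr}(T\,\Phi^*(A))$, that is completely positive with $\Phi^*(I)=I$. An observable $\mathsf F$ is a *preprocessing* of $\mathsf E$ if there is a channel $\Phi$ with $\operatorname{tr}(\varrho\,\mathsf F(X))=\operatorname{tr}(\Phi(\varrho)\mathsf E(X))$ for all states $\varrho$ (positive trace class operators of trace one) and all $X\in\mathcal B(\mathbb T)$; $\mathsf E$ and $\mathsf F$ are *preprocessing equivalent* if each is a preprocessing of the other. A phase observable $\mathsf E$ is *preprocessing clean* if every phase observable $\mathsf F$ of which $\mathsf E$ is a preprocessing is preprocessing equivalent to $\mathsf E$. **Proposition.** (a) Let $\mathsf E$ be a phase observable with phase matrix $(c_{m,n})$. Then $\mathsf E$ is preprocessing equivalent to $\mathsf E_{\mathrm{can}}$ if and only if there exist $n_0\in\mathbb N$ and a sequence $(\lambda_n)_{n\ge n_0}$ in $\mathbb T$ such that $c_{m,n}=\overline{\lambda_m}\,\lambda_n$ for all $m,n\ge n_0$.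 (b) A phase observable is preprocessing clean if and only if it has a phase matrix $(c_{m,n})$ for which there exist $n_0\in\mathbb N$ and a sequence $(\lambda_n)_{n\ge n_0}$ in $\mathbb T$ such that $c_{m,n}=\overline{\lambda_m}\,\lambda_n$ for all $m,n\ge n_0$. -/

import Mathlib

set_option linter.unusedSectionVars false

open MeasureTheory
open scoped CStarAlgebra ComplexOrder

namespace QuantumPhase

noncomputable section

/-! ### Observables -/

/-- An observable (normalized positive operator valued measure) on the measurable space `Ω` with
values in the bounded operators of `H`. Only the values on measurable sets are meaningful, and only
these enter any of the definitions below. The order is the Loewner order, and countable additivity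
holds in the weak operator topology. -/
structure Observable (Ω : Type*) [MeasurableSpace Ω] (H : Type*) [NormedAddCommGroup H]
    [InnerProductSpace ℂ H] [CompleteSpace H] where
  /-- The operator `E(X)`. -/
  effect : Set Ω → (H →L[ℂ] H)
  effect_nonneg : ∀ X, MeasurableSet X → 0 ≤ effect X
  effect_le_one : ∀ X, MeasurableSet X → effect X ≤ 1
  effect_univ : effect Set.univ = 1
  effect_iUnion : ∀ X : ℕ → Set Ω, (∀ i, MeasurableSet (X i)) →
    Pairwise (Function.onFun Disjoint X) → ∀ φ ψ : H,
      HasSum (fun i => inner ℂ φ (effect (X i) ψ)) (inner ℂ φ (effect (⋃ i, X i) ψ))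

/-! ### The torus -/

/-- The Borel `σ`-algebra of the torus `{t ∈ ℂ : |t| = 1}`. -/
instance : MeasurableSpace Circle := borel Circle

instance : BorelSpace Circle := ⟨rfl⟩

/-- The Haar probability measure of the torus. -/
def haarCircle : Measure Circle := Measure.haarMeasure ⊤

instance : IsProbabilityMeasure haarCircle := ⟨Measure.haarMeasure_self⟩

instance : haarCircle.IsMulLeftInvariant := Measure.isMulLeftInvariant_haarMeasure ⊤

variable {H : Type*} [NormedAddCommGroup H] [InnerProductSpace ℂ H] [CompleteSpace H]

/-! ### Trace class operators, states and channels

Throughout, `b` is the number basis `|0⟩, |1⟩, …` of `H`. -/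

/-- The space of trace class operators on `H`: the linear span of the positive bounded operators
`T` with finite trace `∑ₙ ⟨bₙ|T bₙ⟩`. -/
def traceClass (b : HilbertBasis ℕ ℂ H) : Submodule ℂ (H →L[ℂ] H) :=
  Submodule.span ℂ {T | 0 ≤ T ∧ Summable fun n => inner ℂ (b n) (T (b n))}

/-- The trace `∑ₙ ⟨bₙ|T bₙ⟩` of a trace class operator `T`. -/
def trace (b : HilbertBasis ℕ ℂ H) (T : H →L[ℂ] H) : ℂ :=
  ∑' n, inner ℂ (b n) (T (b n))

/-- States: positive trace class operators of trace one. -/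
def IsState (b : HilbertBasis ℕ ℂ H) (ρ : traceClass b) : Prop :=
  0 ≤ (ρ : H →L[ℂ] H) ∧ trace b ρ = 1

/-- A linear map `Φ` on the trace class is a channel if it has an adjoint
`Φ* : L(H) → L(H)`, `tr(Φ(T) A) = tr(T Φ*(A))`, which is completely positive with `Φ*(1) = 1`. -/
def IsChannel (b : HilbertBasis ℕ ℂ H) (Φ : traceClass b →ₗ[ℂ] traceClass b) : Prop :=
  ∃ Ξ : (H →L[ℂ] H) →CP (H →L[ℂ] H), Ξ 1 = 1 ∧
    ∀ (T : traceClass b) (A : H →L[ℂ] H),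
      trace b ((Φ T : H →L[ℂ] H) * A) = trace b ((T : H →L[ℂ] H) * Ξ A)

/-! ### The preprocessing relation -/

/-- `F` is a preprocessing of `E`: there is a channel `Φ` such that for every state `ρ` the outcome
distribution `X ↦ tr(ρ F(X))` of `F` in the state `ρ` is the outcome distribution
`X ↦ tr(Φ(ρ) E(X))` of `E` in the state `Φ(ρ)`. -/
def IsPreprocessing (b : HilbertBasis ℕ ℂ H) (F E : Observable Circle H) : Prop :=
  ∃ Φ : traceClass b →ₗ[ℂ] traceClass b, IsChannel b Φ ∧
    ∀ ρ : traceClass b, IsState b ρ → ∀ X : Set Circle, MeasurableSet X →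
      trace b ((ρ : H →L[ℂ] H) * F.effect X) = trace b ((Φ ρ : H →L[ℂ] H) * E.effect X)

/-- Preprocessing equivalence: each observable is a preprocessing of the other one. -/
def PreprocessingEquiv (b : HilbertBasis ℕ ℂ H) (E F : Observable Circle H) : Prop :=
  IsPreprocessing b E F ∧ IsPreprocessing b F E

/-! ### Phase observables -/

lemma orthonormal_rotated (b : HilbertBasis ℕ ℂ H) (t : Circle) :
    Orthonormal ℂ fun n : ℕ => (t : ℂ) ^ n • b n := by
  have hb := b.orthonormal
  refine ⟨fun n => by simp [norm_smul, hb.1 n, Circle.norm_coe], fun m n hmn => ?_⟩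
  simp [inner_smul_left, inner_smul_right, hb.2 hmn]

lemma dense_rotated (b : HilbertBasis ℕ ℂ H) (t : Circle) :
    ⊤ ≤ (Submodule.span ℂ (Set.range fun n : ℕ => (t : ℂ) ^ n • b n)).topologicalClosure := by
  rw [← b.dense_span]
  refine Submodule.topologicalClosure_mono (Submodule.span_le.2 ?_)
  rintro _ ⟨n, rfl⟩
  have h0 : (t : ℂ) ^ n ≠ 0 := pow_ne_zero _ t.coe_ne_zero
  have h1 := Submodule.smul_mem (Submodule.span ℂ (Set.range fun n : ℕ => (t : ℂ) ^ n • b n))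
    ((t : ℂ) ^ n)⁻¹ (Submodule.subset_span ⟨n, rfl⟩)
  simpa [smul_smul, h0] using h1

/-- The number representation of the torus: `U(t)` is the unitary operator which maps the number
basis `|n⟩` to the orthonormal basis `tⁿ|n⟩`. -/
def numberRep (b : HilbertBasis ℕ ℂ H) (t : Circle) : H ≃ₗᵢ[ℂ] H :=
  b.repr.trans (HilbertBasis.mk (orthonormal_rotated b t) (dense_rotated b t)).repr.symm

/-- `U(t)|n⟩ = tⁿ|n⟩`. -/
lemma numberRep_apply (b : HilbertBasis ℕ ℂ H) (t : Circle) (n : ℕ) :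
    numberRep b t (b n) = (t : ℂ) ^ n • b n := by
  simp [numberRep, HilbertBasis.repr_self]

/-- Phase observables: `U(t) E(X) U(t)* = E(tX)` for all `t` in the torus and all Borel sets
`X`. -/
def IsPhaseObservable (b : HilbertBasis ℕ ℂ H) (E : Observable Circle H) : Prop :=
  ∀ (t : Circle) (X : Set Circle), MeasurableSet X →
    ((numberRep b t : H ≃L[ℂ] H) : H →L[ℂ] H) * E.effect X *
        star ((numberRep b t : H ≃L[ℂ] H) : H →L[ℂ] H) =
      E.effect ((fun x => t * x) '' X)

/-- `c` is the phase matrix of `E`: it is a positive semidefinite `ℕ × ℕ` matrix with unit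
diagonal, and `⟨m|E(X)|n⟩ = c_{m,n} ∫_X t^{m-n} dt` for all `m`, `n` and all Borel sets `X`. -/
structure HasPhaseMatrix (b : HilbertBasis ℕ ℂ H) (E : Observable Circle H)
    (c : Matrix ℕ ℕ ℂ) : Prop where
  posSemidef : c.PosSemidef
  diag : ∀ n, c n n = 1
  inner_effect : ∀ (m n : ℕ) (X : Set Circle), MeasurableSet X →
    inner ℂ (b m) (E.effect X (b n)) =
      c m n * ∫ t in X, (t : ℂ) ^ ((m : ℤ) - (n : ℤ)) ∂haarCircle

/-- A phase observable `E` is preprocessing clean (in the set of phase observables) if every phase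
observable `F` of which `E` is a preprocessing is preprocessing equivalent to `E`. -/
def IsPreprocessingClean (b : HilbertBasis ℕ ℂ H) (E : Observable Circle H) : Prop :=
  ∀ F : Observable Circle H, IsPhaseObservable b F →
    IsPreprocessing b E F → PreprocessingEquiv b E F

/-! ### The canonical phase observable -/

lemma integral_zpow_haarCircle {k : ℤ} (hk : k ≠ 0) :
    ∫ t : Circle, (t : ℂ) ^ k ∂haarCircle = 0 := by
  set s : Circle := Circle.exp (Real.pi / k) with hs
  have hsk : (s : ℂ) ^ k = -1 := by
    have hk0 : (k : ℂ) ≠ 0 := by exact_mod_cast hk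
    rw [hs, Circle.coe_exp, ← Complex.exp_int_mul]
    rw [← Complex.exp_pi_mul_I]
    congr 1
    push_cast
    field_simp
  have h := integral_mul_left_eq_self (μ := haarCircle) (fun t : Circle => (t : ℂ) ^ k) s
  simp only [Circle.coe_mul, mul_zpow, hsk, neg_one_mul, integral_neg] at h
  exact self_eq_neg.1 h.symm

lemma continuous_zpow_circle (k : ℤ) : Continuous fun t : Circle => (t : ℂ) ^ k :=
  Continuous.zpow₀ continuous_subtype_val k fun t : Circle => Or.inl t.coe_ne_zero

/-- The function `t ↦ t ^ (-n)` in `L²` of the torus. -/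
def monomialLp (n : ℕ) : Lp ℂ 2 haarCircle :=
  MemLp.toLp (fun t : Circle => (t : ℂ) ^ (-(n : ℤ)))
    (MemLp.of_bound (continuous_zpow_circle _).aestronglyMeasurable 1
      (by simp [Circle.norm_coe]))

lemma monomialLp_coeFn (n : ℕ) :
    monomialLp n =ᵐ[haarCircle] fun t : Circle => (t : ℂ) ^ (-(n : ℤ)) :=
  MemLp.coeFn_toLp _

lemma inner_zpow_circle (m n : ℕ) (t : Circle) :
    inner ℂ ((t : ℂ) ^ (-(m : ℤ))) ((t : ℂ) ^ (-(n : ℤ))) = (t : ℂ) ^ ((m : ℤ) - (n : ℤ)) := by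
  have ht := t.coe_ne_zero
  rw [RCLike.inner_apply, map_zpow₀, ← Circle.coe_inv_eq_conj, Circle.coe_inv, inv_zpow', neg_neg,
    ← zpow_add₀ ht]
  congr 1
  ring

lemma orthonormal_monomialLp : Orthonormal ℂ monomialLp := by
  have key : ∀ m n : ℕ, inner ℂ (monomialLp m) (monomialLp n) =
      ∫ t : Circle, (t : ℂ) ^ ((m : ℤ) - (n : ℤ)) ∂haarCircle := fun m n => by
    rw [L2.inner_def]
    refine integral_congr_ae ?_
    filter_upwards [monomialLp_coeFn m, monomialLp_coeFn n] with t hm hn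
    rw [hm, hn, inner_zpow_circle]
  rw [orthonormal_iff_ite]
  intro m n
  rw [key]
  split_ifs with h
  · simp [h]
  · exact integral_zpow_haarCircle (by omega)

/-- The isometry of `H` into `L²` of the torus which maps `|n⟩` to `t ↦ t ^ (-n)`. -/
def hardyEmbedding (b : HilbertBasis ℕ ℂ H) : H →ₗᵢ[ℂ] Lp ℂ 2 haarCircle :=
  orthonormal_monomialLp.orthogonalFamily.linearIsometry.comp b.repr.toLinearIsometry

lemma hardyEmbedding_apply (b : HilbertBasis ℕ ℂ H) (n : ℕ) :
    hardyEmbedding b (b n) = monomialLp n := by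
  simp [hardyEmbedding, HilbertBasis.repr_self]

/-- The map `H → L²(X)`, `ψ ↦ (V ψ)|_X`, with `V` the isometry `hardyEmbedding`. -/
def hardyRestrict (b : HilbertBasis ℕ ℂ H) (X : Set Circle) :
    H →L[ℂ] Lp ℂ 2 (haarCircle.restrict X) :=
  (LpToLpRestrictCLM Circle ℂ ℂ haarCircle 2 X).comp (hardyEmbedding b).toContinuousLinearMap

/-- The operator `Ecan(X) = V* 1_X V`, with `V` the isometry `hardyEmbedding`. -/
def canonicalEffect (b : HilbertBasis ℕ ℂ H) (X : Set Circle) : H →L[ℂ] H :=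
  (ContinuousLinearMap.adjoint (hardyRestrict b X)).comp (hardyRestrict b X)

lemma inner_canonicalEffect (b : HilbertBasis ℕ ℂ H) (X : Set Circle) (φ ψ : H) :
    inner ℂ φ (canonicalEffect b X ψ) =
      ∫ t in X, inner ℂ (hardyEmbedding b φ t) (hardyEmbedding b ψ t) ∂haarCircle := by
  rw [canonicalEffect, ContinuousLinearMap.comp_apply, ContinuousLinearMap.adjoint_inner_right,
    L2.inner_def]
  refine integral_congr_ae ?_
  filter_upwards [LpToLpRestrictCLM_coeFn ℂ X (hardyEmbedding b φ),
    LpToLpRestrictCLM_coeFn ℂ X (hardyEmbedding b ψ)] with t h1 h2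
  exact congrArg₂ (inner ℂ) h1 h2

lemma canonicalEffect_univ (b : HilbertBasis ℕ ℂ H) : canonicalEffect b Set.univ = 1 := by
  refine ContinuousLinearMap.ext fun ψ => ext_inner_left ℂ fun φ => ?_
  rw [inner_canonicalEffect, Measure.restrict_univ, ← L2.inner_def, LinearIsometry.inner_map_map]
  rfl

lemma inner_canonicalEffect_iUnion (b : HilbertBasis ℕ ℂ H) {ι : Type} [Countable ι]
    (X : ι → Set Circle) (hX : ∀ i, MeasurableSet (X i))
    (hd : Pairwise (Function.onFun Disjoint X)) (φ ψ : H) :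
    HasSum (fun i => inner ℂ φ (canonicalEffect b (X i) ψ))
      (inner ℂ φ (canonicalEffect b (⋃ i, X i) ψ)) := by
  simp only [inner_canonicalEffect]
  exact hasSum_integral_iUnion hX hd (L2.integrable_inner _ _).integrableOn

lemma canonicalEffect_nonneg (b : HilbertBasis ℕ ℂ H) (X : Set Circle) :
    0 ≤ canonicalEffect b X := by
  rw [ContinuousLinearMap.nonneg_iff_isPositive]
  exact ContinuousLinearMap.isPositive_adjoint_comp_self _

lemma canonicalEffect_add_compl (b : HilbertBasis ℕ ℂ H) {X : Set Circle} (hX : MeasurableSet X) :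
    canonicalEffect b X + canonicalEffect b Xᶜ = 1 := by
  refine ContinuousLinearMap.ext fun ψ => ext_inner_left ℂ fun φ => ?_
  rw [← canonicalEffect_univ b, add_apply, inner_add_right]
  simp only [inner_canonicalEffect]
  rw [integral_add_compl hX (L2.integrable_inner _ _), Measure.restrict_univ]

/-- The canonical phase observable `Ecan`, realized as `Ecan(X) = V* 1_X V`. -/
def canonicalPhase (b : HilbertBasis ℕ ℂ H) : Observable Circle H where
  effect := canonicalEffect b
  effect_nonneg X _ := canonicalEffect_nonneg b X
  effect_le_one X hX := by
    rw [← canonicalEffect_add_compl b hX]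
    exact le_add_of_nonneg_right (canonicalEffect_nonneg b Xᶜ)
  effect_univ := canonicalEffect_univ b
  effect_iUnion X hX hd φ ψ := inner_canonicalEffect_iUnion b X hX hd φ ψ

/-- `Ecan` is the observable with the phase matrix `c_{m,n} = 1`. -/
lemma hasPhaseMatrix_canonicalPhase (b : HilbertBasis ℕ ℂ H) :
    HasPhaseMatrix b (canonicalPhase b) (Matrix.of fun _ _ => 1) where
  posSemidef := by
    refine ⟨by ext; simp [Matrix.conjTranspose_apply], fun x => ?_⟩
    have h : (x.sum fun i xi => x.sum fun j xj => star xi * 1 * xj) =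
        star (x.sum fun _ xi => xi) * x.sum fun _ xi => xi := by
      simp [Finsupp.sum, Finset.sum_mul_sum]
    exact h.symm ▸ star_mul_self_nonneg _
  diag _ := rfl
  inner_effect m n X _ := by
    rw [Matrix.of_apply, one_mul]
    refine (inner_canonicalEffect b X (b m) (b n)).trans (integral_congr_ae ?_)
    rw [hardyEmbedding_apply, hardyEmbedding_apply]
    filter_upwards [ae_restrict_of_ae (monomialLp_coeFn m),
      ae_restrict_of_ae (monomialLp_coeFn n)] with t hm hn
    rw [hm, hn, inner_zpow_circle]

/-- `Ecan` is a phase observable. -/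
lemma isPhaseObservable_canonicalPhase (b : HilbertBasis ℕ ℂ H) :
    IsPhaseObservable b (canonicalPhase b) := by
  intro t X hX
  have hstar : ∀ n : ℕ, star ((numberRep b t : H ≃L[ℂ] H) : H →L[ℂ] H) (b n) =
      ((t : ℂ) ^ n)⁻¹ • b n := by
    intro n
    have h0 : (t : ℂ) ^ n ≠ 0 := pow_ne_zero _ t.coe_ne_zero
    have h1 : b n = ((numberRep b t : H ≃L[ℂ] H) : H →L[ℂ] H) (((t : ℂ) ^ n)⁻¹ • b n) := by
      rw [map_smul]
      change _ = _ • numberRep b t (b n)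
      rw [numberRep_apply, smul_smul, inv_mul_cancel₀ h0, one_smul]
    refine ext_inner_left ℂ fun φ => ?_
    conv_lhs => rw [h1]
    rw [ContinuousLinearMap.star_eq_adjoint, ContinuousLinearMap.adjoint_inner_right]
    exact (numberRep b t).inner_map_map _ _
  have hset : (fun x => t * x) '' X = (fun x => t⁻¹ * x) ⁻¹' X :=
    (Equiv.mulLeft t).image_eq_preimage_symm X
  have hX' : MeasurableSet ((fun x => t * x) '' X) := by
    rw [hset]; exact (measurable_const_mul t⁻¹) hX
  have hmat : ∀ m n : ℕ,
      inner ℂ (b m) ((((numberRep b t : H ≃L[ℂ] H) : H →L[ℂ] H) * (canonicalPhase b).effect X *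
        star ((numberRep b t : H ≃L[ℂ] H) : H →L[ℂ] H)) (b n)) =
      inner ℂ (b m) ((canonicalPhase b).effect ((fun x => t * x) '' X) (b n)) := by
    intro m n
    have ht := t.coe_ne_zero
    rw [mul_assoc, mul_apply_eq_comp, ← ContinuousLinearMap.adjoint_inner_left,
      ← ContinuousLinearMap.star_eq_adjoint, hstar m, mul_apply_eq_comp, hstar n,
      map_smul, inner_smul_left, inner_smul_right,
      (hasPhaseMatrix_canonicalPhase b).inner_effect m n X hX,
      (hasPhaseMatrix_canonicalPhase b).inner_effect m n _ hX', Matrix.of_apply, one_mul, one_mul]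
    rw [← integral_indicator hX, ← integral_indicator hX',
      ← integral_mul_left_eq_self (μ := haarCircle) (Set.indicator ((fun x => t * x) '' X) _) t,
      ← mul_assoc, ← integral_const_mul]
    congr 1
    funext x
    have hmem : t * x ∈ (fun x => t * x) '' X ↔ x ∈ X := by simp
    by_cases hx : x ∈ X
    · rw [Set.indicator_of_mem hx, Set.indicator_of_mem (hmem.2 hx), Circle.coe_mul, mul_zpow,
        zpow_sub₀ ht, zpow_natCast, zpow_natCast, map_inv₀, map_pow, ← Circle.coe_inv_eq_conj,
        Circle.coe_inv, inv_pow, inv_inv]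
      rfl
    · rw [Set.indicator_of_notMem hx, Set.indicator_of_notMem (fun h => hx (hmem.1 h)), mul_zero]
  refine ContinuousLinearMap.ext_on
    ((Submodule.dense_iff_topologicalClosure_eq_top).2 b.dense_span) ?_
  rintro _ ⟨n, rfl⟩
  refine b.repr.injective (lp.ext (funext fun m => ?_))
  rw [b.repr_apply_apply, b.repr_apply_apply]
  exact hmat m n

end

end QuantumPhase

/-! In the Heisenberg picture, `F` is a preprocessing of `E` when a normal unital completely
positive map `Ξ` sends `E(X)` to `F(X)` for all `X` (`isPreprocessing_iff`).

The effects of an observable with phase matrix `c` are the Schur products of `c` with the canonical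
effects, and Schur multiplication by a positive semidefinite matrix with unit diagonal is such a map
(`exists_schur`). So the canonical observable lies above every phase observable. As every phase
observable has a phase matrix (`IsPhaseObservable.exists_hasPhaseMatrix`), being clean means being
equivalent to the canonical one, and (b) follows from (a).

If `c` is a rank-one matrix of phases from `n₀` on, compression by the isometry `|j⟩ ↦ conj (lam (n₀
+ j)) |n₀ + j⟩` turns `E` into the canonical observable.

Conversely, let `Ξ` send `E` to the canonical observable. Integrating `t⁻ᵏ` gives `Ξ C = S`, where
`S` is the isometric shift by `k` and `C` the shift with weights `c (j + k) j`, all of modulus at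
most one. Kadison-Schwarz yields `1 = ‖S|0⟩‖² ≤ ⟨0|Ξ(C* C)|0⟩`. Normality provides an `n`, the same
for all `k`, with `⟨0|Ξ(|n⟩⟨n|)|0⟩ > 0`. A weight `c (n + k) n` of modulus below one would then push
the right side below one (`exists_norm_eq_one_of_isPreprocessing`). Positive semidefiniteness turns
a column of unimodular entries into a rank-one tail (`exists_phases`). -/

namespace QuantumPhase

variable {H : Type*} [NormedAddCommGroup H] [InnerProductSpace ℂ H] [CompleteSpace H]

/-! ### Positivity of operators and of operator matrices -/

lemma nonneg_iff_inner (A : H →L[ℂ] H) : 0 ≤ A ↔ ∀ φ : H, 0 ≤ inner ℂ φ (A φ) := by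
  rw [ContinuousLinearMap.nonneg_iff_isPositive, ContinuousLinearMap.isPositive_iff_complex]
  refine forall_congr' fun φ => ?_
  rw [← inner_conj_symm (A φ) φ, Complex.nonneg_iff]
  generalize inner ℂ φ (A φ) = z
  constructor
  · rintro ⟨h1, h2⟩
    have h3 : z.im = 0 := by simpa using congrArg Complex.im h1
    exact ⟨by simpa using h2, h3.symm⟩
  · rintro ⟨h1, h2⟩
    refine ⟨?_, by simpa using h1⟩
    apply Complex.ext
    · simp
    · simpa using h2.symm

lemma ext_inner_basis (b : HilbertBasis ℕ ℂ H) {A B : H →L[ℂ] H}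
    (h : ∀ m n, inner ℂ (b m) (A (b n)) = inner ℂ (b m) (B (b n))) : A = B := by
  refine ContinuousLinearMap.ext_on
    ((Submodule.dense_iff_topologicalClosure_eq_top).2 b.dense_span) ?_
  rintro _ ⟨n, rfl⟩
  refine b.repr.injective (lp.ext (funext fun m => ?_))
  rw [b.repr_apply_apply, b.repr_apply_apply]
  exact h m n

lemma ext_inner_self {A B : H →L[ℂ] H} (h : ∀ φ, inner ℂ φ (A φ) = inner ℂ φ (B φ)) : A = B := by
  have := (ext_inner_map (A : H →ₗ[ℂ] H) (B : H →ₗ[ℂ] H)).1 fun φ => by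
    simpa using congrArg (starRingEnd ℂ) (h φ)
  exact ContinuousLinearMap.coe_injective this

lemma exists_eq_star_mul_self {A : Type*} [CStarAlgebra A] [PartialOrder A] [StarOrderedRing A]
    {a : A} (ha : 0 ≤ a) : ∃ n : A, a = star n * n :=
  CStarAlgebra.nonneg_iff_eq_star_mul_self.1 ha

/-- Here `n` is the negative part `a⁻`. Since `a⁻ a a⁻ = -(a⁻)³`, positivity of `a` follows once
this compression is shown to vanish: two uses of the C*-identity lead from `(a⁻)³ = 0` to `a⁻ = 0`.
-/
lemma exists_negPart {A : Type*} [CStarAlgebra A] [PartialOrder A] [StarOrderedRing A] {a : A}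
    (ha : IsSelfAdjoint a) :
    ∃ n : A, 0 ≤ n ∧ a * n = -(n * n) ∧ (star n * n * n = 0 → 0 ≤ a) := by
  have hn : star a⁻ = a⁻ := (IsSelfAdjoint.of_nonneg (CFC.negPart_nonneg a)).star_eq
  refine ⟨a⁻, CFC.negPart_nonneg a, ?_, fun h => (CFC.negPart_eq_zero_iff a ha).1 ?_⟩
  · have h1 : (a⁺ - a⁻) * a⁻ = -(a⁻ * a⁻) := by
      rw [sub_mul, CFC.posPart_mul_negPart, zero_sub]
    rwa [CFC.posPart_sub_negPart a ha] at h1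
  · rw [hn] at h
    have h1 : star (a⁻ * a⁻) * (a⁻ * a⁻) = 0 := by
      rw [star_mul, hn, ← mul_assoc, h, zero_mul]
    have h2 := (CStarRing.star_mul_self_eq_zero_iff _).1 h1
    nth_rw 1 [← hn] at h2
    exact (CStarRing.star_mul_self_eq_zero_iff _).1 h2

/-- The quadratic form `x ↦ ∑ᵢⱼ ⟨xᵢ|Mᵢⱼ xⱼ⟩` of a matrix of operators. -/
noncomputable def matrixForm {k : ℕ} (M : CStarMatrix (Fin k) (Fin k) (H →L[ℂ] H))
    (x : Fin k → H) : ℂ :=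
  ∑ i, ∑ j, inner ℂ (x i) (M i j (x j))

lemma matrixForm_conj {k : ℕ} (N M : CStarMatrix (Fin k) (Fin k) (H →L[ℂ] H)) (x : Fin k → H) :
    matrixForm (star N * M * N) x = matrixForm M fun i => ∑ j, N i j (x j) := by
  have h : ∀ i j, inner ℂ (x i) ((star N * M * N) i j (x j)) =
      ∑ k, ∑ l, inner ℂ (N k i (x i)) (M k l (N l j (x j))) := fun i j => by
    simp only [CStarMatrix.mul_apply, CStarMatrix.star_apply, inner_sum, sum_apply,
      Finset.sum_mul, mul_apply_eq_comp, ContinuousLinearMap.star_eq_adjoint,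
      ContinuousLinearMap.adjoint_inner_right]
    exact Finset.sum_comm
  simp only [matrixForm, h, sum_inner, inner_sum, map_sum]
  calc _ = ∑ i, ∑ k, ∑ j, ∑ l, inner ℂ (N k i (x i)) (M k l (N l j (x j))) :=
        Finset.sum_congr rfl fun i _ => Finset.sum_comm
    _ = ∑ k, ∑ i, ∑ j, ∑ l, inner ℂ (N k i (x i)) (M k l (N l j (x j))) := Finset.sum_comm
    _ = ∑ k, ∑ i, ∑ l, ∑ j, inner ℂ (N k i (x i)) (M k l (N l j (x j))) :=
        Finset.sum_congr rfl fun k _ => Finset.sum_congr rfl fun i _ => Finset.sum_comm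
    _ = ∑ k, ∑ l, ∑ i, ∑ j, inner ℂ (N k i (x i)) (M k l (N l j (x j))) :=
        Finset.sum_congr rfl fun k _ => Finset.sum_comm
    _ = _ := Finset.sum_congr rfl fun k _ => Finset.sum_congr rfl fun l _ => Finset.sum_comm

lemma matrixForm_star {k : ℕ} (M : CStarMatrix (Fin k) (Fin k) (H →L[ℂ] H)) (x : Fin k → H) :
    matrixForm (star M) x = starRingEnd ℂ (matrixForm M x) := by
  simp only [matrixForm, CStarMatrix.star_apply, ContinuousLinearMap.star_eq_adjoint,
    ContinuousLinearMap.adjoint_inner_right, map_sum, inner_conj_symm]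
  exact Finset.sum_comm

lemma matrixForm_sub {k : ℕ} (M N : CStarMatrix (Fin k) (Fin k) (H →L[ℂ] H)) (x : Fin k → H) :
    matrixForm (M - N) x = matrixForm M x - matrixForm N x := by
  simp [matrixForm, Finset.sum_sub_distrib]

/-- `M` acts as an operator on the Hilbert sum of `k` copies of `H`, and over `ℂ` an operator with
zero quadratic form is zero. -/
lemma eq_zero_of_matrixForm {k : ℕ} {M : CStarMatrix (Fin k) (Fin k) (H →L[ℂ] H)}
    (h : ∀ x, matrixForm M x = 0) : M = 0 := by
  let T : PiLp 2 (fun _ : Fin k => H) →ₗ[ℂ] PiLp 2 (fun _ : Fin k => H) :=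
    { toFun := fun x => WithLp.toLp 2 fun i => ∑ j, M i j (x j)
      map_add' := fun x y => by ext i; simp [Finset.sum_add_distrib]
      map_smul' := fun a x => by ext i; simp [Finset.smul_sum] }
  have hT : T = 0 := by
    refine (inner_map_self_eq_zero T).1 fun x => ?_
    rw [← inner_conj_symm, PiLp.inner_apply]
    have h1 : ∑ i, inner ℂ (x i) ((T x) i) = 0 := by simpa [T, matrixForm, inner_sum] using h x
    simpa using congrArg (starRingEnd ℂ) h1
  ext i j ψ : 3
  have := congrArg (fun S => S (WithLp.toLp 2 (Pi.single j ψ)) i) hT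
  simpa [T, Pi.single_apply, apply_ite] using this

/-- This makes the abstract C*-order in the definition of complete positivity computable. For the
converse, real values of the form make `M` self-adjoint. With `N` its negative part, the form of `N
M N = -N³` is nonnegative, being that of `M` at `N x`, while `N³ = N* N N` has a nonnegative form as
well. -/
lemma cstarMatrix_nonneg_iff {k : ℕ} (M : CStarMatrix (Fin k) (Fin k) (H →L[ℂ] H)) :
    0 ≤ M ↔ ∀ x, 0 ≤ matrixForm M x := by
  have key : ∀ M : CStarMatrix (Fin k) (Fin k) (H →L[ℂ] H), 0 ≤ M → ∀ x, 0 ≤ matrixForm M x := by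
    intro M hM x
    obtain ⟨N, rfl⟩ := exists_eq_star_mul_self hM
    rw [← mul_one (star N), matrixForm_conj]
    refine Finset.sum_nonneg fun i _ => ?_
    rw [Finset.sum_eq_single i (fun j _ hj => by simp [hj.symm])
      (by simp)]
    rw [CStarMatrix.one_apply_eq]
    exact (nonneg_iff_inner (1 : H →L[ℂ] H)).1 zero_le_one _
  refine ⟨key M, fun h => ?_⟩
  have hsa : IsSelfAdjoint M := by
    refine sub_eq_zero.1 (eq_zero_of_matrixForm fun x => ?_)
    rw [matrixForm_sub, matrixForm_star, sub_eq_zero]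
    exact Complex.conj_eq_iff_im.2 (Complex.nonneg_iff.1 (h x)).2.symm
  obtain ⟨N, hN0, hMN, hN⟩ := exists_negPart hsa
  have hNs : star N = N := (IsSelfAdjoint.of_nonneg hN0).star_eq
  refine hN ?_
  refine eq_zero_of_matrixForm fun x => le_antisymm ?_ ?_
  · have h1 := h fun i => ∑ j, N i j (x j)
    rw [← matrixForm_conj, hNs, mul_assoc, hMN] at h1
    rw [hNs, mul_assoc]
    have h2 := matrixForm_sub 0 (N * (N * N)) x
    rw [zero_sub] at h2
    rw [mul_neg, h2] at h1
    simpa [matrixForm] using h1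
  · rw [matrixForm_conj]
    exact key N hN0 _

/-! ### Completely positive maps -/

/-- The Kadison-Schwarz inequality. -/
lemma norm_sq_le_inner_of_cp (Ξ : (H →L[ℂ] H) →CP (H →L[ℂ] H)) (h1 : Ξ 1 = 1) (A : H →L[ℂ] H)
    (φ : H) : ((‖Ξ A φ‖ ^ 2 : ℝ) : ℂ) ≤ inner ℂ φ (Ξ (star A * A) φ) := by
  -- `N* N` has rows `(1, A)` and `(A*, A* A)`. Its image under `Ξ` is positive, and at the vector
  -- `(-Ξ A φ, φ)` all terms but `⟨φ|Ξ(A* A) φ⟩ - ‖Ξ A φ‖²` cancel.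
  let N : CStarMatrix (Fin 2) (Fin 2) (H →L[ℂ] H) := CStarMatrix.ofMatrix !![1, A; 0, 0]
  have hN : 0 ≤ (star N * N).map Ξ := Ξ.map_cstarMatrix_nonneg _ (star_mul_self_nonneg N)
  have hs : Ξ (star A) = star (Ξ A) := by
    have h := congrFun (congrFun (IsSelfAdjoint.of_nonneg hN).star_eq 1) 0
    simpa [CStarMatrix.star_apply, CStarMatrix.mul_apply, N] using h.symm
  have h := (cstarMatrix_nonneg_iff _).1 hN ![-(Ξ A φ), φ]
  simp only [matrixForm, Fin.sum_univ_two, CStarMatrix.map_apply, CStarMatrix.mul_apply,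
    CStarMatrix.star_apply, N] at h
  have h2 : inner ℂ φ (Ξ (star A) (Ξ A φ)) = ((‖Ξ A φ‖ ^ 2 : ℝ) : ℂ) := by
    rw [hs, ContinuousLinearMap.star_eq_adjoint, ContinuousLinearMap.adjoint_inner_right,
      inner_self_eq_norm_sq_to_K]
    norm_cast
  simp [h1] at h
  simpa only [h2] using h

/-- The composition of completely positive maps. -/
noncomputable def cpComp (Ξ₁ Ξ₂ : (H →L[ℂ] H) →CP (H →L[ℂ] H)) : (H →L[ℂ] H) →CP (H →L[ℂ] H) where
  toLinearMap := Ξ₁.toLinearMap ∘ₗ Ξ₂.toLinearMap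
  map_cstarMatrix_nonneg' k M hM :=
    Ξ₁.map_cstarMatrix_nonneg' k _ (Ξ₂.map_cstarMatrix_nonneg' k M hM)

/-! ### Trace class and preprocessing -/

lemma hasSum_rankOne_mul (b : HilbertBasis ℕ ℂ H) (φ ψ : H) (A : H →L[ℂ] H) :
    HasSum (fun n => inner ℂ (b n) ((InnerProductSpace.rankOne ℂ φ ψ * A) (b n)))
      (inner ℂ ψ (A φ)) := by
  have h := b.hasSum_inner_mul_inner (ContinuousLinearMap.adjoint A ψ) φ
  simp only [ContinuousLinearMap.adjoint_inner_left] at h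
  simpa [inner_smul_right] using h

lemma trace_rankOne_mul (b : HilbertBasis ℕ ℂ H) (φ ψ : H) (A : H →L[ℂ] H) :
    trace b (InnerProductSpace.rankOne ℂ φ ψ * A) = inner ℂ ψ (A φ) :=
  (hasSum_rankOne_mul b φ ψ A).tsum_eq

lemma trace_mul_rankOne_basis (b : HilbertBasis ℕ ℂ H) (n : ℕ) (A : H →L[ℂ] H) :
    trace b (A * InnerProductSpace.rankOne ℂ (b n) (b n)) = inner ℂ (b n) (A (b n)) := by
  rw [trace, tsum_eq_single n]
  · simp [inner_self_eq_norm_sq_to_K, b.orthonormal.1 n]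
  · intro m hm
    simp [orthonormal_iff_ite.1 b.orthonormal n m, hm.symm]

/-- The one-dimensional operator `|φ⟩⟨φ|` as a trace class operator. -/
noncomputable def pureState (b : HilbertBasis ℕ ℂ H) (φ : H) : traceClass b :=
  ⟨InnerProductSpace.rankOne ℂ φ φ, Submodule.subset_span
    ⟨(ContinuousLinearMap.nonneg_iff_isPositive _).2
      (InnerProductSpace.isPositive_rankOne_self φ), by
      simpa using (hasSum_rankOne_mul b φ φ 1).summable⟩⟩

lemma isState_pureState (b : HilbertBasis ℕ ℂ H) {φ : H} (hφ : ‖φ‖ = 1) :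
    IsState b (pureState b φ) := by
  refine ⟨(ContinuousLinearMap.nonneg_iff_isPositive _).2
      (InnerProductSpace.isPositive_rankOne_self φ), ?_⟩
  have h := trace_rankOne_mul b φ φ 1
  rw [mul_one] at h
  exact h.trans (by simp [inner_self_eq_norm_sq_to_K, hφ])

/-- In the Heisenberg picture, preprocessing is the application of a normal unital completely
positive map to the effects. -/
lemma isPreprocessing_iff (b : HilbertBasis ℕ ℂ H) (F E : Observable Circle H) :
    IsPreprocessing b F E ↔ ∃ (Φ : traceClass b →ₗ[ℂ] traceClass b)
      (Ξ : (H →L[ℂ] H) →CP (H →L[ℂ] H)), Ξ 1 = 1 ∧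
      (∀ (T : traceClass b) (A : H →L[ℂ] H),
        trace b ((Φ T : H →L[ℂ] H) * A) = trace b ((T : H →L[ℂ] H) * Ξ A)) ∧
      ∀ X, MeasurableSet X → F.effect X = Ξ (E.effect X) := by
  constructor
  · rintro ⟨Φ, ⟨Ξ, h1, hΞ⟩, h⟩
    refine ⟨Φ, Ξ, h1, hΞ, fun X hX => ext_inner_self fun φ => ?_⟩
    -- Pure states already determine an operator; other vectors reduce to unit vectors by scaling.
    have hu : ∀ u : H, ‖u‖ = 1 →
        inner ℂ u (F.effect X u) = inner ℂ u (Ξ (E.effect X) u) := fun u hu => by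
      have := h _ (isState_pureState b hu) X hX
      rw [hΞ] at this
      simpa only [pureState, trace_rankOne_mul] using this
    rcases eq_or_ne φ 0 with rfl | hφ
    · simp
    · have hφ' : φ = (‖φ‖ : ℂ) • ((‖φ‖ : ℂ)⁻¹ • φ) := by
        rw [smul_smul, mul_inv_cancel₀ (by simpa using hφ), one_smul]
      rw [hφ']
      generalize hv : (‖φ‖ : ℂ)⁻¹ • φ = v
      have := hu v (by rw [← hv, norm_smul]; simp [hφ])
      simp [this]
  · rintro ⟨Φ, Ξ, h1, hΞ, h⟩
    exact ⟨Φ, ⟨Ξ, h1, hΞ⟩, fun ρ _ X hX => by rw [hΞ, h X hX]⟩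

lemma IsPreprocessing.trans {b : HilbertBasis ℕ ℂ H} {F E G : Observable Circle H}
    (hFE : IsPreprocessing b F E) (hEG : IsPreprocessing b E G) : IsPreprocessing b F G := by
  rw [isPreprocessing_iff] at *
  obtain ⟨Φ₁, Ξ₁, h1, hΞ1, hF⟩ := hFE
  obtain ⟨Φ₂, Ξ₂, h2, hΞ2, hE⟩ := hEG
  refine ⟨Φ₂ ∘ₗ Φ₁, cpComp Ξ₁ Ξ₂, (congrArg Ξ₁ h2).trans h1, fun T A => ?_, fun X hX => ?_⟩
  · exact (hΞ2 (Φ₁ T) A).trans (hΞ1 T (Ξ₂ A))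
  · rw [hF X hX, hE X hX]; rfl

/-! ### Schur multipliers -/

open Filter Topology in
/-- Bounded sequences of operators have limit points in the weak operator topology. -/
lemma exists_weak_limit (T : ℕ → H → H → ℂ) (C : ℝ)
    (hadd₁ : ∀ N φ φ' ψ, T N (φ + φ') ψ = T N φ ψ + T N φ' ψ)
    (hsmul₁ : ∀ N (a : ℂ) φ ψ, T N (a • φ) ψ = starRingEnd ℂ a * T N φ ψ)
    (hadd₂ : ∀ N φ ψ ψ', T N φ (ψ + ψ') = T N φ ψ + T N φ ψ')
    (hsmul₂ : ∀ N (a : ℂ) φ ψ, T N φ (a • ψ) = a * T N φ ψ)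
    (hC : ∀ N φ ψ, ‖T N φ ψ‖ ≤ C * ‖φ‖ * ‖ψ‖) :
    ∃ S : H →L[ℂ] H, ∀ φ ψ, Tendsto (fun N => T N φ ψ) (hyperfilter ℕ) (𝓝 (inner ℂ φ (S ψ))) := by
  -- An ultrafilter converges in every compact disc, so the limits exist for all pairs `φ`, `ψ` at
  -- once, without passing to subsequences.
  have hL : ∀ φ ψ, ∃ z, Tendsto (fun N => T N φ ψ) (hyperfilter ℕ) (𝓝 z) := fun φ ψ => by
    obtain ⟨z, -, hz⟩ := (isCompact_closedBall (0 : ℂ) (C * ‖φ‖ * ‖ψ‖)).ultrafilter_le_nhds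
      ((hyperfilter ℕ).map fun N => T N φ ψ) (by
        rw [le_principal_iff, Ultrafilter.coe_map]
        exact mem_map.2 (Eventually.of_forall fun N => by simpa using hC N φ ψ))
    exact ⟨z, hz⟩
  choose L hL using hL
  let B : H →ₗ⋆[ℂ] H →ₗ[ℂ] ℂ := LinearMap.mk₂'ₛₗ (starRingEnd ℂ) (RingHom.id ℂ) L
    (fun φ φ' ψ => tendsto_nhds_unique (hL _ _)
      (((hL φ ψ).add (hL φ' ψ)).congr fun N => (hadd₁ N φ φ' ψ).symm))
    (fun a φ ψ => tendsto_nhds_unique (hL _ _)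
      (((hL φ ψ).const_mul _).congr fun N => (hsmul₁ N a φ ψ).symm))
    (fun φ ψ ψ' => tendsto_nhds_unique (hL _ _)
      (((hL φ ψ).add (hL φ ψ')).congr fun N => (hadd₂ N φ ψ ψ').symm))
    (fun a φ ψ => tendsto_nhds_unique (hL _ _)
      (((hL φ ψ).const_mul _).congr fun N => (hsmul₂ N a φ ψ).symm))
  have hLC : ∀ φ ψ, ‖L φ ψ‖ ≤ C * ‖φ‖ * ‖ψ‖ := fun φ ψ => by
    have h := (hL φ ψ).norm
    exact le_of_tendsto' h fun N => hC N φ ψ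
  let B' : H →L⋆[ℂ] H →L[ℂ] ℂ := B.mkContinuous₂ C hLC
  refine ⟨ContinuousLinearMap.adjoint (InnerProductSpace.continuousLinearMapOfBilin B'),
    fun φ ψ => ?_⟩
  rw [ContinuousLinearMap.adjoint_inner_right,
    InnerProductSpace.continuousLinearMapOfBilin_apply]
  exact hL φ ψ

open scoped MatrixOrder in
/-- Kraus operators of the truncated Schur multiplier. -/
lemma exists_truncated_kraus (b : HilbertBasis ℕ ℂ H) {c : Matrix ℕ ℕ ℂ} (hc : c.PosSemidef)
    (hd : ∀ n, c n n = 1) (N : ℕ) :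
    ∃ D : Fin N → (H →L[ℂ] H), (∀ φ, ∑ l, ‖D l φ‖ ^ 2 ≤ ‖φ‖ ^ 2) ∧
      ∀ i j, i < N → j < N → ∀ A : H →L[ℂ] H,
        ∑ l, inner ℂ (D l (b i)) (A (D l (b j))) = c i j * inner ℂ (b i) (A (b j)) := by
  -- The `N × N` corner of `c` is factored as `B* B`. The `l`-th Kraus operator is diagonal with
  -- entries from row `l` of `B`, and `c n n = 1` makes each column of `B` a unit vector.
  obtain ⟨B, hB⟩ := CStarAlgebra.nonneg_iff_eq_star_mul_self.1
    (hc.submatrix (fun i : Fin N => (i : ℕ))).nonneg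
  have hB' : ∀ i j : Fin N, c i j = ∑ l, starRingEnd ℂ (B l i) * B l j := fun i j => by
    simpa [Matrix.mul_apply, Matrix.star_eq_conjTranspose, Matrix.conjTranspose_apply] using congrFun (congrFun hB i) j
  have hbN : Orthonormal ℂ fun n : Fin N => b n := b.orthonormal.comp _ Fin.val_injective
  have hDb : ∀ (l j : Fin N), (∑ n : Fin N, B l n • InnerProductSpace.rankOne ℂ (b n) (b n)) (b j) =
      B l j • b j := fun l j => by
    rw [sum_apply, Finset.sum_eq_single j]
    · simp [inner_self_eq_norm_sq_to_K, b.orthonormal.1 j]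
    · intro n _ hn
      have := hbN.2 hn
      simp [this]
    · simp
  refine ⟨fun l => ∑ n, B l n • InnerProductSpace.rankOne ℂ (b n) (b n), fun φ => ?_,
    fun i j hi hj A => ?_⟩
  · refine le_trans (le_of_eq ?_) (hbN.sum_inner_products_le φ (s := Finset.univ))
    have h : ∀ l, ‖(∑ n : Fin N, B l n • InnerProductSpace.rankOne ℂ (b n) (b n)) φ‖ ^ 2 =
        ∑ n, ‖B l n‖ ^ 2 * ‖inner ℂ (b n) φ‖ ^ 2 := fun l => by
      have h0 := hbN.inner_sum (fun n => B l n * inner ℂ (b n) φ)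
        (fun n => B l n * inner ℂ (b n) φ) Finset.univ
      rw [inner_self_eq_norm_sq_to_K] at h0
      simp only [Complex.conj_mul', norm_mul] at h0
      simp only [sum_apply, smul_apply, InnerProductSpace.rankOne_apply, smul_smul, ← mul_pow]
      apply Complex.ofReal_injective
      push_cast at h0 ⊢
      exact h0
    simp only [h]
    rw [Finset.sum_comm]
    refine Finset.sum_congr rfl fun n _ => ?_
    rw [← Finset.sum_mul]
    have h2 : ((∑ l, ‖B l n‖ ^ 2 : ℝ) : ℂ) = 1 := by
      rw [← hd n, hB' n n]
      push_cast
      exact Finset.sum_congr rfl fun l _ => by rw [← Complex.conj_mul']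
    rw [show (∑ l, ‖B l n‖ ^ 2 : ℝ) = 1 by exact_mod_cast h2, one_mul]
  · simp only [hDb _ ⟨i, hi⟩, hDb _ ⟨j, hj⟩, hB' ⟨i, hi⟩ ⟨j, hj⟩, map_smul, inner_smul_left,
      inner_smul_right, Finset.sum_mul]
    exact Finset.sum_congr rfl fun l _ => by ring

/-- Schur multiplication by a positive semidefinite matrix with unit diagonal is a completely
positive map. -/
lemma exists_schur (b : HilbertBasis ℕ ℂ H) {c : Matrix ℕ ℕ ℂ} (hc : c.PosSemidef)
    (hd : ∀ n, c n n = 1) :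
    ∃ Ξ : (H →L[ℂ] H) →CP (H →L[ℂ] H), ∀ A m n,
      inner ℂ (b m) (Ξ A (b n)) = c m n * inner ℂ (b m) (A (b n)) := by
  choose D hD hDc using exists_truncated_kraus b hc hd
  have hbd : ∀ (A : H →L[ℂ] H) N φ ψ,
      ‖∑ l, inner ℂ (D N l φ) (A (D N l ψ))‖ ≤ ‖A‖ * ‖φ‖ * ‖ψ‖ := fun A N φ ψ => by
    calc _ ≤ ∑ l, ‖A‖ * (‖D N l φ‖ * ‖D N l ψ‖) := by
          refine (norm_sum_le _ _).trans (Finset.sum_le_sum fun l _ => ?_)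
          refine (norm_inner_le_norm _ _).trans ?_
          calc _ ≤ ‖D N l φ‖ * (‖A‖ * ‖D N l ψ‖) := by gcongr; exact A.le_opNorm _
            _ = _ := by ring
      _ ≤ ‖A‖ * (‖φ‖ * ‖ψ‖) := by
          rw [← Finset.mul_sum]
          gcongr
          refine (Real.sum_mul_le_sqrt_mul_sqrt _ _ _).trans ?_
          exact mul_le_mul (Real.sqrt_le_iff.2 ⟨norm_nonneg _, hD N _⟩)
            (Real.sqrt_le_iff.2 ⟨norm_nonneg _, hD N _⟩) (Real.sqrt_nonneg _) (norm_nonneg _)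
      _ = _ := by ring
  have hS : ∀ A : H →L[ℂ] H, _ := fun A => exists_weak_limit
    (fun N φ ψ => ∑ l, inner ℂ (D N l φ) (A (D N l ψ))) ‖A‖
    (fun N φ φ' ψ => by simp [Finset.sum_add_distrib])
    (fun N a φ ψ => by simp [Finset.mul_sum, mul_comm])
    (fun N φ ψ ψ' => by simp [Finset.sum_add_distrib])
    (fun N a φ ψ => by simp [Finset.mul_sum])
    (hbd A)
  choose S hS using hS
  -- For `N > m + n` the truncated entry already has its final value, so the limit does not depend
  -- on the ultrafilter. Linearity follows from the entries, complete positivity from the limit.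
  have hent : ∀ A m n, inner ℂ (b m) (S A (b n)) = c m n * inner ℂ (b m) (A (b n)) := by
    intro A m n
    refine tendsto_nhds_unique (hS A (b m) (b n)) (tendsto_const_nhds.congr' ?_)
    refine (Filter.Eventually.filter_mono (Nat.hyperfilter_le_atTop)
      (Filter.eventually_ge_atTop (m + n + 1))).mono fun N hN => ?_
    exact (hDc N m n (by omega) (by omega) A).symm
  refine ⟨{ toFun := S
            map_add' := fun A B => ext_inner_basis b fun m n => by
              simp [hent, mul_add]
            map_smul' := fun a A => ext_inner_basis b fun m n => by
              simp [hent, mul_left_comm]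
            map_cstarMatrix_nonneg' := fun k M hM => ?_ }, hent⟩
  rw [cstarMatrix_nonneg_iff] at hM ⊢
  intro x
  have ht : Filter.Tendsto
      (fun N => ∑ i, ∑ j, ∑ l, inner ℂ (D N l (x i)) (M i j (D N l (x j))))
      (Filter.hyperfilter ℕ) (nhds (∑ i, ∑ j, inner ℂ (x i) (S (M i j) (x j)))) :=
    tendsto_finsetSum _ fun i _ => tendsto_finsetSum _ fun j _ => hS _ _ _
  refine ge_of_tendsto' ht fun N => ?_
  calc (0 : ℂ) ≤ ∑ l, matrixForm M fun i => D N l (x i) := Finset.sum_nonneg fun l _ => hM _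
    _ = ∑ i, ∑ l, ∑ j, inner ℂ (D N l (x i)) (M i j (D N l (x j))) := Finset.sum_comm
    _ = _ := Finset.sum_congr rfl fun i _ => Finset.sum_comm

/-- The adjoint `Ξ` of the channel is Schur multiplication by `c`. The channel itself is Schur
multiplication by the transpose, because `tr(T A)` pairs the entry `(n, m)` of `T` with the entry
`(m, n)` of `A`. It keeps positivity and the diagonal, hence the trace class. -/
lemma hasPhaseMatrix_isPreprocessing_canonicalPhase (b : HilbertBasis ℕ ℂ H)
    {E : Observable Circle H} {c : Matrix ℕ ℕ ℂ} (hE : HasPhaseMatrix b E c) :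
    IsPreprocessing b E (canonicalPhase b) := by
  obtain ⟨Ξ, hΞ⟩ := exists_schur b hE.posSemidef hE.diag
  obtain ⟨Θ, hΘ⟩ := exists_schur b hE.posSemidef.transpose hE.diag
  have hmem : ∀ T ∈ traceClass b, Θ.toLinearMap T ∈ traceClass b := by
    intro T hT
    refine (Submodule.span_le (p := (traceClass b).comap Θ.toLinearMap)).2 ?_ hT
    rintro T ⟨hT0, hTs⟩
    refine Submodule.subset_span ⟨?_, ?_⟩
    · have := OrderHomClass.mono Θ hT0
      rwa [map_zero] at this
    · refine hTs.congr fun n => ?_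
      exact ((hΘ T n n).trans (by rw [Matrix.transpose_apply, hE.diag, one_mul])).symm
  refine (isPreprocessing_iff b _ _).2 ⟨Θ.toLinearMap.restrict hmem, Ξ, ?_, fun T A => ?_,
    fun X hX => ?_⟩
  · refine ext_inner_basis b fun m n => ?_
    rw [hΞ]
    rcases eq_or_ne m n with rfl | h
    · simp [hE.diag]
    · simp [b.orthonormal.2 h]
  · refine tsum_congr fun n => ?_
    have key : ∀ (B : H →L[ℂ] H) (y : H), inner ℂ (b n) (B y) =
        ∑' m, inner ℂ (b n) (B (b m)) * inner ℂ (b m) y := fun B y => by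
      rw [← ContinuousLinearMap.adjoint_inner_left, ← b.tsum_inner_mul_inner]
      simp only [ContinuousLinearMap.adjoint_inner_left]
    rw [mul_apply_eq_comp, mul_apply_eq_comp, key, key]
    refine tsum_congr fun m => ?_
    rw [hΞ]
    refine (congrArg (· * _) (hΘ _ n m)).trans ?_
    change c m n * inner ℂ (b n) ((T : H →L[ℂ] H) (b m)) * inner ℂ (b m) (A (b n)) = _
    ring
  · refine ext_inner_basis b fun m n => ?_
    rw [hΞ, hE.inner_effect m n X hX, (hasPhaseMatrix_canonicalPhase b).inner_effect m n X hX,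
      Matrix.of_apply, one_mul]

/-! ### Integration with respect to an observable -/

namespace Observable

lemma effect_empty {Ω : Type*} [MeasurableSpace Ω] (E : Observable Ω H) : E.effect ∅ = 0 := by
  refine ext_inner_self fun φ => ?_
  have h := E.effect_iUnion (fun _ => ∅) (fun _ => .empty) (fun _ _ _ => Set.disjoint_empty _) φ φ
  simpa using (summable_const_iff _).1 h.summable

/-- The distribution `X ↦ ⟨φ|E(X) φ⟩` of the observable `E` in the vector state `φ`. -/
noncomputable def distribution {Ω : Type*} [MeasurableSpace Ω] (E : Observable Ω H) (φ : H) :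
    Measure Ω :=
  Measure.ofMeasurable (fun X _ => ENNReal.ofReal (inner ℂ φ (E.effect X φ)).re)
    (by simp [E.effect_empty]) fun X hX hd => by
      have h := Complex.hasSum_re (E.effect_iUnion X hX hd φ φ)
      rw [← h.tsum_eq, ENNReal.ofReal_tsum_of_nonneg _ h.summable]
      exact fun i => (Complex.nonneg_iff.1
        ((nonneg_iff_inner _).1 (E.effect_nonneg _ (hX i)) φ)).1

variable {Ω : Type*} [MeasurableSpace Ω] (E : Observable Ω H) (φ : H)

lemma distribution_apply {X : Set Ω} (hX : MeasurableSet X) :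
    E.distribution φ X = ENNReal.ofReal (inner ℂ φ (E.effect X φ)).re :=
  Measure.ofMeasurable_apply X hX

instance : IsFiniteMeasure (E.distribution φ) :=
  ⟨by rw [distribution_apply _ _ .univ]; exact ENNReal.ofReal_lt_top⟩

lemma distribution_real {X : Set Ω} (hX : MeasurableSet X) :
    ((E.distribution φ).real X : ℂ) = inner ℂ φ (E.effect X φ) := by
  have h := Complex.nonneg_iff.1 ((nonneg_iff_inner _).1 (E.effect_nonneg _ hX) φ)
  rw [measureReal_def, distribution_apply _ _ hX, ENNReal.toReal_ofReal h.1]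
  exact Complex.ext rfl h.2

lemma distribution_real_univ : (E.distribution φ).real Set.univ = ‖φ‖ ^ 2 := by
  have h := E.distribution_real φ .univ
  rw [E.effect_univ] at h
  apply Complex.ofReal_injective
  rw [h]
  simp

/-- The integral of a simple function with respect to an observable. -/
noncomputable def simpleIntegral (g : SimpleFunc Ω ℂ) : H →L[ℂ] H :=
  ∑ z ∈ g.range, z • E.effect (g ⁻¹' {z})

lemma inner_simpleIntegral (g : SimpleFunc Ω ℂ) :
    inner ℂ φ (E.simpleIntegral g φ) = ∫ t, g t ∂(E.distribution φ) := by
  rw [SimpleFunc.integral_eq_sum _ (SimpleFunc.integrable_of_isFiniteMeasure g), simpleIntegral]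
  simp only [sum_apply, smul_apply, inner_sum, inner_smul_right, Complex.real_smul,
    E.distribution_real φ (g.measurableSet_fiber _), mul_comm]

end Observable

/-- The numerical radius bounds half the norm. Integrals against `E` are controlled only through
their quadratic forms, and this turns uniform closeness of integrands into norm closeness of
operators. Polarization and the parallelogram law bound `⟨T ψ|φ⟩`; then `φ` is taken along `T ψ`
with `‖φ‖ = ‖ψ‖`. -/
lemma norm_le_of_norm_inner_self_le (T : H →L[ℂ] H) {ε : ℝ} (hε : 0 ≤ ε)
    (h : ∀ φ, ‖inner ℂ φ (T φ)‖ ≤ ε * ‖φ‖ ^ 2) : ‖T‖ ≤ 2 * ε := by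
  have h' : ∀ φ, ‖inner ℂ (T φ) φ‖ ≤ ε * ‖φ‖ ^ 2 := fun φ => by
    rw [norm_inner_symm]; exact h φ
  have hp : ∀ φ ψ, ‖inner ℂ (T ψ) φ‖ ≤ ε * (‖φ‖ ^ 2 + ‖ψ‖ ^ 2) := fun φ ψ => by
    have e1 := parallelogram_law_with_norm ℂ φ ψ
    have e2 := parallelogram_law_with_norm ℂ φ (Complex.I • ψ)
    rw [norm_smul, Complex.norm_I, one_mul] at e2
    have e3 := inner_map_polarization (T : H →ₗ[ℂ] H) φ ψ
    simp only [ContinuousLinearMap.coe_coe] at e3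
    rw [e3, norm_div, Complex.norm_ofNat, div_le_iff₀ four_pos]
    calc _ ≤ ‖inner ℂ (T (φ + ψ)) (φ + ψ)‖ + ‖inner ℂ (T (φ - ψ)) (φ - ψ)‖ +
          ‖inner ℂ (T (φ + Complex.I • ψ)) (φ + Complex.I • ψ)‖ +
          ‖inner ℂ (T (φ - Complex.I • ψ)) (φ - Complex.I • ψ)‖ := by
          refine (norm_sub_le _ _).trans (add_le_add ((norm_add_le _ _).trans
            (add_le_add (norm_sub_le _ _) ?_)) ?_) <;>
            rw [norm_mul, Complex.norm_I, one_mul]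
      _ ≤ ε * ‖φ + ψ‖ ^ 2 + ε * ‖φ - ψ‖ ^ 2 + ε * ‖φ + Complex.I • ψ‖ ^ 2 +
          ε * ‖φ - Complex.I • ψ‖ ^ 2 := by gcongr <;> exact h' _
      _ = _ := by linear_combination ε * e1 + ε * e2
  refine T.opNorm_le_bound (by positivity) fun ψ => ?_
  rcases eq_or_ne (T ψ) 0 with h0 | h0
  · rw [h0, norm_zero]; positivity
  have hψ : 0 < ‖ψ‖ := norm_pos_iff.2 fun h => h0 (by rw [h, map_zero])
  have h1 := hp (((‖ψ‖ / ‖T ψ‖ : ℝ) : ℂ) • T ψ) ψ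
  have hT := norm_pos_iff.2 h0
  rw [inner_smul_right, norm_mul, inner_self_eq_norm_sq_to_K, norm_smul, Complex.norm_real,
    Real.norm_of_nonneg (by positivity), div_mul_cancel₀ _ hT.ne'] at h1
  simp only [Complex.coe_algebraMap, norm_pow, Complex.norm_real, norm_norm] at h1
  have h2 : ‖ψ‖ * ‖T ψ‖ ≤ ‖ψ‖ * (2 * ε * ‖ψ‖) := by
    calc _ = ‖ψ‖ / ‖T ψ‖ * ‖T ψ‖ ^ 2 := by field_simp
      _ ≤ _ := h1
      _ = _ := by ring
  exact le_of_mul_le_mul_left h2 hψ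

lemma exists_simpleFunc_near {Ω : Type*} [TopologicalSpace Ω] [CompactSpace Ω] [MeasurableSpace Ω]
    [BorelSpace Ω] {f : Ω → ℂ} (hf : Continuous f) {ε : ℝ} (hε : 0 < ε) :
    ∃ g : SimpleFunc Ω ℂ, ∀ t, ‖g t - f t‖ ≤ ε := by
  obtain ⟨s, hs⟩ := (isCompact_range hf).elim_finite_subcover
    (fun n => Metric.ball (TopologicalSpace.denseSeq ℂ n) ε) (fun _ => Metric.isOpen_ball)
    (fun x _ => Set.mem_iUnion.2 ((TopologicalSpace.denseRange_denseSeq ℂ).exists_dist_lt x hε))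
  -- `s.sup id` is the largest index in the finite subcover, so every centre of the cover competes
  -- for the nearest point.
  refine ⟨(SimpleFunc.nearestPt (TopologicalSpace.denseSeq ℂ) (s.sup id)).comp f hf.measurable,
    fun t => ?_⟩
  obtain ⟨n, hn, hx⟩ := Set.mem_iUnion₂.1 (hs ⟨t, rfl⟩)
  rw [← dist_eq_norm]
  have h := SimpleFunc.edist_nearestPt_le (TopologicalSpace.denseSeq ℂ) (f t)
    (Finset.le_sup (f := id) hn)
  rw [edist_dist, edist_dist, ENNReal.ofReal_le_ofReal_iff dist_nonneg] at h
  exact h.trans (by rw [dist_comm]; exact (Metric.mem_ball.1 hx).le)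

lemma integral_simpleFunc_mul {Ω : Type*} [MeasurableSpace Ω] {μ : Measure Ω} (g : SimpleFunc Ω ℂ)
    {h : Ω → ℂ} (hh : Integrable h μ) :
    ∫ t, g t * h t ∂μ = ∑ z ∈ g.range, z * ∫ t in g ⁻¹' {z}, h t ∂μ := by
  have e : (fun t => g t * h t) =
      fun t => ∑ z ∈ g.range, (g ⁻¹' {z}).indicator (fun t => z * h t) t := by
    funext t
    rw [Finset.sum_eq_single (g t) (fun z _ hz => Set.indicator_of_notMem (fun h => hz h.symm) _)
      (fun h => absurd (SimpleFunc.mem_range_self g t) h)]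
    simp
  rw [e, integral_finsetSum _ fun z _ => (hh.const_mul z).indicator (g.measurableSet_fiber z)]
  refine Finset.sum_congr rfl fun z _ => ?_
  rw [integral_indicator (g.measurableSet_fiber z), integral_const_mul]

lemma integrable_zpow_circle (μ : Measure Circle) [IsFiniteMeasure μ] (k : ℤ) :
    Integrable (fun t : Circle => (t : ℂ) ^ k) μ :=
  (memLp_one_iff_integrable).1 (MemLp.of_bound (continuous_zpow_circle _).aestronglyMeasurable 1
      (by simp [Circle.norm_coe]))

open Filter Topology in
/-- If `gₙ → t⁻ᵏ` uniformly, then the integrals of `gₙ` with respect to `E` converge in norm to a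
weighted shift by `k`. -/
lemma exists_tendsto_simpleIntegral (b : HilbertBasis ℕ ℂ H) {E : Observable Circle H}
    {c : Matrix ℕ ℕ ℂ} (hE : HasPhaseMatrix b E c) (k : ℕ) {g : ℕ → SimpleFunc Circle ℂ}
    (hg : ∀ N t, ‖g N t - (t : ℂ) ^ (-(k : ℤ))‖ ≤ 1 / ((N : ℝ) + 1)) :
    ∃ C : H →L[ℂ] H, Tendsto (fun N => E.simpleIntegral (g N)) atTop (𝓝 C) ∧
      ∀ m n, inner ℂ (b m) (C (b n)) = if m = n + k then c m n else 0 := by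
  -- The factor 4 is 2 from the triangle inequality through `t⁻ᵏ`, times 2 from the numerical radius
  -- bound.
  have hcau : CauchySeq fun N => E.simpleIntegral (g N) := by
    refine cauchySeq_of_le_tendsto_0 (fun N : ℕ => 4 * (1 / ((N : ℝ) + 1))) (fun n m N hn hm => ?_)
      (by simpa using tendsto_one_div_add_atTop_nhds_zero_nat.const_mul (4 : ℝ))
    have hb : ∀ n, N ≤ n → 1 / ((n : ℝ) + 1) ≤ 1 / ((N : ℝ) + 1) := fun n hn => by
      gcongr
    rw [dist_eq_norm]
    refine (norm_le_of_norm_inner_self_le _ (ε := 2 * (1 / ((N : ℝ) + 1))) (by positivity)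
      fun φ => ?_).trans (by linarith)
    rw [sub_apply, inner_sub_right, E.inner_simpleIntegral,
      E.inner_simpleIntegral, ← integral_sub (SimpleFunc.integrable_of_isFiniteMeasure _)
      (SimpleFunc.integrable_of_isFiniteMeasure _), ← E.distribution_real_univ]
    refine norm_integral_le_of_norm_le_const (Eventually.of_forall fun t => ?_)
    have h1 := (hg n t).trans (hb n hn)
    have h2 := (hg m t).trans (hb m hm)
    calc ‖g n t - g m t‖ = ‖(g n t - (t : ℂ) ^ (-(k : ℤ))) - (g m t - (t : ℂ) ^ (-(k : ℤ)))‖ := by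
          congr 1; ring
      _ ≤ _ := norm_sub_le _ _
      _ ≤ _ := by linarith
  obtain ⟨C, hC⟩ := cauchySeq_tendsto_of_complete hcau
  refine ⟨C, hC, fun m n => ?_⟩
  have h1 : Tendsto (fun N => inner ℂ (b m) (E.simpleIntegral (g N) (b n))) atTop
      (𝓝 (inner ℂ (b m) (C (b n)))) :=
    tendsto_const_nhds.inner
      (((ContinuousLinearMap.apply ℂ H (b n)).continuous.tendsto C).comp hC)
  refine tendsto_nhds_unique h1 ?_
  -- Matrix entries of the integral are Haar integrals against `t ^ (m - n)`; in the limit,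
  -- orthogonality of characters leaves only `m = n + k`.
  have h2 : ∀ N, inner ℂ (b m) (E.simpleIntegral (g N) (b n)) =
      c m n * ∫ t, g N t * (t : ℂ) ^ ((m : ℤ) - (n : ℤ)) ∂haarCircle := fun N => by
    rw [integral_simpleFunc_mul _ (integrable_zpow_circle _ _), Finset.mul_sum,
      Observable.simpleIntegral, sum_apply, inner_sum]
    refine Finset.sum_congr rfl fun z _ => ?_
    rw [smul_apply, inner_smul_right, hE.inner_effect _ _ _ ((g N).measurableSet_fiber z)]
    ring
  have h3 : (if m = n + k then c m n else 0) =
      c m n * ∫ t : Circle, (t : ℂ) ^ (-(k : ℤ)) * (t : ℂ) ^ ((m : ℤ) - (n : ℤ)) ∂haarCircle := by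
    simp only [← zpow_add₀ (Circle.coe_ne_zero _)]
    split_ifs with h
    · simp [h]
    · rw [integral_zpow_haarCircle (by omega), mul_zero]
  simp only [h2]
  rw [h3]
  refine Tendsto.const_mul _ (tendsto_iff_norm_sub_tendsto_zero.2 ?_)
  refine squeeze_zero (fun _ => norm_nonneg _) (fun N => ?_)
    tendsto_one_div_add_atTop_nhds_zero_nat
  have hi : Integrable (fun t : Circle => g N t * (t : ℂ) ^ ((m : ℤ) - (n : ℤ))) haarCircle :=
    (integrable_zpow_circle _ _).bdd_mul (g N).aestronglyMeasurable
      (c := ∑ z ∈ (g N).range, ‖z‖)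
      (Eventually.of_forall fun t => Finset.single_le_sum (f := fun z : ℂ => ‖z‖)
        (fun _ _ => norm_nonneg _) (SimpleFunc.mem_range_self _ t))
  have hi' : Integrable
      (fun t : Circle => (t : ℂ) ^ (-(k : ℤ)) * (t : ℂ) ^ ((m : ℤ) - (n : ℤ))) haarCircle := by
    simp only [← zpow_add₀ (Circle.coe_ne_zero _)]
    exact integrable_zpow_circle _ _
  rw [← integral_sub hi hi']
  refine (norm_integral_le_of_norm_le_const (C := 1 / ((N : ℝ) + 1))
    (Eventually.of_forall fun t => ?_)).trans (by simp)
  rw [← sub_mul, norm_mul, norm_zpow, Circle.norm_coe, one_zpow, mul_one]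
  exact hg N t

/-! ### Preprocessings of `E` that are canonical -/

lemma adjoint_basis_of_diagonal (b : HilbertBasis ℕ ℂ H) {D : H →L[ℂ] H} {d : ℕ → ℝ}
    (hD : ∀ n, D (b n) = (d n : ℂ) • b n) (n : ℕ) :
    ContinuousLinearMap.adjoint D (b n) = (d n : ℂ) • b n := by
  refine b.repr.injective (lp.ext (funext fun m => ?_))
  rw [b.repr_apply_apply, b.repr_apply_apply, ContinuousLinearMap.adjoint_inner_right, hD,
    inner_smul_left, inner_smul_right]
  rcases eq_or_ne m n with rfl | h
  · simp
  · simp [b.orthonormal.2 h]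

lemma nonneg_of_diagonal (b : HilbertBasis ℕ ℂ H) {D : H →L[ℂ] H} {d : ℕ → ℝ} (hd : ∀ n, 0 ≤ d n)
    (hD : ∀ n, D (b n) = (d n : ℂ) • b n) : 0 ≤ D := by
  refine (nonneg_iff_inner D).2 fun φ => ?_
  refine (b.hasSum_inner_mul_inner φ (D φ)).nonneg fun n => ?_
  rw [← ContinuousLinearMap.adjoint_inner_left, adjoint_basis_of_diagonal b hD, inner_smul_left,
    Complex.conj_ofReal, mul_left_comm, ← inner_conj_symm, Complex.conj_mul']
  exact mul_nonneg (Complex.zero_le_real.2 (hd n)) (by positivity)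

/-- The principal minor on `i`, `j` equals `1 - ‖c i j‖²`; a repeated index does no harm. -/
lemma norm_le_one_of_posSemidef {c : Matrix ℕ ℕ ℂ} (hc : c.PosSemidef) (hd : ∀ n, c n n = 1)
    (i j : ℕ) : ‖c i j‖ ≤ 1 := by
  have h := (hc.submatrix ![i, j]).det_nonneg
  have h1 : c j i = starRingEnd ℂ (c i j) := (hc.1.apply i j).symm ▸ by simp
  simp only [Matrix.det_fin_two, Matrix.submatrix_apply, Matrix.cons_val_zero,
    Matrix.cons_val_one, hd, h1, Complex.mul_conj'] at h
  have h2 := (Complex.nonneg_iff.1 h).1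
  norm_cast at h2
  simp at h2
  have := norm_nonneg (c i j)
  nlinarith

/-- If the canonical observable is a preprocessing of `E`, then some row of the phase matrix of `E`
consists of numbers of modulus one beyond the diagonal. -/
lemma exists_norm_eq_one_of_isPreprocessing (b : HilbertBasis ℕ ℂ H) {E : Observable Circle H}
    {c : Matrix ℕ ℕ ℂ} (hE : HasPhaseMatrix b E c) (h : IsPreprocessing b (canonicalPhase b) E) :
    ∃ n, ∀ k, 1 ≤ ‖c (n + k) n‖ := by
  obtain ⟨Φ, Ξ, h1, hΦ, hΞ⟩ := (isPreprocessing_iff b _ _).1 h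
  -- `Φ(|0⟩⟨0|)` has trace one, so some diagonal entry is nonzero. This is where normality enters,
  -- and `n` is fixed before `k`.
  obtain ⟨n, hn⟩ : ∃ n, inner ℂ (b n) ((Φ (pureState b (b 0)) : H →L[ℂ] H) (b n)) ≠ 0 := by
    by_contra! h0
    have h2 := hΦ (pureState b (b 0)) 1
    rw [h1, pureState, trace_rankOne_mul, mul_one, trace] at h2
    rw [pureState] at h0
    simp [h0, inner_self_eq_norm_sq_to_K, b.orthonormal.1 0] at h2
  rw [← trace_mul_rankOne_basis, hΦ, pureState, trace_rankOne_mul] at hn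
  refine ⟨n, fun k => ?_⟩
  by_contra! hlt
  -- The same simple functions are used for both observables, so `Ξ` matches their integrals term by
  -- term and, being norm continuous, also the limits `C` and `S`.
  choose g hg using fun N : ℕ => exists_simpleFunc_near (continuous_zpow_circle (-(k : ℤ)))
    (Nat.one_div_pos_of_nat (α := ℝ) (n := N))
  obtain ⟨C, hC, hCe⟩ := exists_tendsto_simpleIntegral b hE k hg
  obtain ⟨S, hS, hSe⟩ := exists_tendsto_simpleIntegral b (hasPhaseMatrix_canonicalPhase b) k hg
  have hΞC : Ξ C = S := by
    refine tendsto_nhds_unique (((map_continuous Ξ).tendsto C).comp hC) (hS.congr fun N => ?_)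
    simp only [Observable.simpleIntegral, Function.comp_apply, map_sum, map_smul]
    exact Finset.sum_congr rfl fun z _ => by rw [hΞ _ ((g N).measurableSet_fiber z)]
  have hCb : ∀ j, C (b j) = c (j + k) j • b (j + k) := fun j => by
    refine b.repr.injective (lp.ext (funext fun m => ?_))
    rw [b.repr_apply_apply, b.repr_apply_apply, hCe, inner_smul_right,
      orthonormal_iff_ite.1 b.orthonormal]
    split_ifs with hm <;> simp [hm]
  have hSb : S (b 0) = b k := by
    refine b.repr.injective (lp.ext (funext fun m => ?_))
    rw [b.repr_apply_apply, b.repr_apply_apply, hSe, orthonormal_iff_ite.1 b.orthonormal]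
    simp
  have hc1 := norm_le_one_of_posSemidef hE.posSemidef hE.diag
  have hCC : ∀ j, (star C * C) (b j) = ((‖c (j + k) j‖ ^ 2 : ℝ) : ℂ) • b j := fun j => by
    refine b.repr.injective (lp.ext (funext fun m => ?_))
    rw [b.repr_apply_apply, b.repr_apply_apply, mul_apply_eq_comp,
      ContinuousLinearMap.star_eq_adjoint, ContinuousLinearMap.adjoint_inner_right, hCb, hCb,
      inner_smul_left, inner_smul_right, inner_smul_right, orthonormal_iff_ite.1 b.orthonormal,
      orthonormal_iff_ite.1 b.orthonormal]
    rcases eq_or_ne m j with rfl | hm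
    · simp [Complex.conj_mul']
    · simp [hm]
  -- `1 - C* C` is diagonal with nonnegative entries, and its whole `n`-th entry is subtracted.
  -- After `Ξ`, evaluation at `b 0` gives `1 - x - r y ≥ 0`, against `x ≥ 1`, `r > 0` and `y > 0`.
  have hle : 0 ≤ 1 - star C * C - ((1 - ‖c (n + k) n‖ ^ 2 : ℝ) : ℂ) •
      InnerProductSpace.rankOne ℂ (b n) (b n) := by
    refine nonneg_of_diagonal b
      (d := fun j => if j = n then 0 else 1 - ‖c (j + k) j‖ ^ 2) (fun j => ?_) fun j => ?_
    · split_ifs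
      · exact le_rfl
      · have := hc1 (j + k) j
        have := norm_nonneg (c (j + k) j)
        nlinarith
    · rw [sub_apply, sub_apply, hCC, smul_apply, InnerProductSpace.rankOne_apply,
        orthonormal_iff_ite.1 b.orthonormal]
      rcases eq_or_ne j n with rfl | hj
      · simp [sub_smul]
      · simp [hj, hj.symm, sub_smul]
  have hle2 := OrderHomClass.mono Ξ hle
  rw [map_zero, map_sub, map_sub, map_smul, h1, nonneg_iff_inner] at hle2
  have hr : 0 < 1 - ‖c (n + k) n‖ ^ 2 := by
    have := norm_nonneg (c (n + k) n)
    nlinarith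
  have h3 := hle2 (b 0)
  have h4 := norm_sq_le_inner_of_cp Ξ h1 C (b 0)
  rw [hΞC, hSb, b.orthonormal.1 k] at h4
  have hp := OrderHomClass.mono Ξ ((ContinuousLinearMap.nonneg_iff_isPositive _).2
    (InnerProductSpace.isPositive_rankOne_self (𝕜 := ℂ) (b n)))
  rw [map_zero, nonneg_iff_inner] at hp
  have h5 := hp (b 0)
  rw [sub_apply, sub_apply, smul_apply, inner_sub_right, inner_sub_right, inner_smul_right,
    one_apply_eq_self, inner_self_eq_norm_sq_to_K, b.orthonormal.1 0] at h3
  generalize 1 - ‖c (n + k) n‖ ^ 2 = r at h3 hr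
  generalize inner ℂ (b 0) (Ξ (star C * C) (b 0)) = x at h3 h4
  generalize inner ℂ (b 0) (Ξ (InnerProductSpace.rankOne ℂ (b n) (b n)) (b 0)) = y at h3 h5 hn
  obtain ⟨h5r, h5i⟩ := Complex.nonneg_iff.1 h5
  have h3r := (Complex.nonneg_iff.1 h3).1
  have h4r := (Complex.le_def.1 h4).1
  rw [Complex.sub_re, Complex.re_ofReal_mul] at h3r
  simp at h3r h4r
  have hy : 0 < y.re := lt_of_le_of_ne h5r fun h => hn (Complex.ext h.symm h5i.symm)
  have := mul_pos hr hy
  linarith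

/-- Take `lam p = c n p`. As `c n q` has modulus one, `(-c n q, 1, 0)` is isotropic for the
submatrix on `n, q, p`, hence lies in its kernel; the third coordinate reads `c p q = c p n * c n
q`. -/
lemma exists_phases {c : Matrix ℕ ℕ ℂ} (hc : c.PosSemidef) (hd : ∀ n, c n n = 1) {n : ℕ}
    (h : ∀ k, 1 ≤ ‖c (n + k) n‖) :
    ∃ lam : ℕ → Circle, ∀ p q, n ≤ p → n ≤ q →
      c p q = starRingEnd ℂ (lam p : ℂ) * (lam q : ℂ) := by
  have hh : ∀ i j, starRingEnd ℂ (c i j) = c j i := fun i j => hc.1.apply j i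
  have hn : ∀ p, n ≤ p → ‖c n p‖ = 1 := fun p hp => by
    refine le_antisymm (norm_le_one_of_posSemidef hc hd n p) ?_
    obtain ⟨k, rfl⟩ := Nat.exists_eq_add_of_le hp
    rw [← hh, RCLike.norm_conj]
    exact h k
  have hz : ∀ p, ∃ z : Circle, n ≤ p → (z : ℂ) = c n p := fun p => by
    by_cases hp : n ≤ p
    · exact ⟨⟨c n p, mem_sphere_zero_iff_norm.2 (hn p hp)⟩, fun _ => rfl⟩
    · exact ⟨1, fun h => absurd h hp⟩
  choose lam hlam using hz
  refine ⟨lam, fun p q hp hq => ?_⟩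
  have h1 : c q n * c n q = 1 := by
    rw [← hh n q, Complex.conj_mul', hn q hq]; simp
  have h0 := ((hc.submatrix ![n, q, p]).dotProduct_mulVec_zero_iff ![-c n q, 1, 0]).1 (by
    simp [dotProduct, Matrix.mulVec, Fin.sum_univ_three, hd, h1])
  have h2 := congrFun h0 2
  simp [dotProduct, Matrix.mulVec, Fin.sum_univ_three] at h2
  rw [hlam p hp, hlam q hq, hh]
  linear_combination h2

/-- A phase observable whose phase matrix is eventually of rank one is mapped to the canonical one
by compression with a weighted shift. -/
lemma isPreprocessing_canonicalPhase_of_phases (b : HilbertBasis ℕ ℂ H) {E : Observable Circle H}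
    {c : Matrix ℕ ℕ ℂ} (hE : HasPhaseMatrix b E c) {n₀ : ℕ} {lam : ℕ → Circle}
    (h : ∀ m n, n₀ ≤ m → n₀ ≤ n → c m n = starRingEnd ℂ (lam m : ℂ) * (lam n : ℂ)) :
    IsPreprocessing b (canonicalPhase b) E := by
  have hl : ∀ n, starRingEnd ℂ (lam n : ℂ) * (lam n : ℂ) = 1 := fun n => by
    rw [Complex.conj_mul', Circle.norm_coe]; simp
  have ho : Orthonormal ℂ fun j => starRingEnd ℂ (lam (n₀ + j) : ℂ) • b (n₀ + j) := by
    refine ⟨fun j => by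
      rw [norm_smul, RCLike.norm_conj, Circle.norm_coe, b.orthonormal.1, one_mul], fun i j hij => ?_⟩
    simp [inner_smul_left, inner_smul_right, b.orthonormal.2 (show n₀ + i ≠ n₀ + j by omega)]
  let W₀ : H →ₗᵢ[ℂ] H := ho.orthogonalFamily.linearIsometry.comp b.repr.toLinearIsometry
  have hW₀ : ∀ j, W₀ (b j) = starRingEnd ℂ (lam (n₀ + j) : ℂ) • b (n₀ + j) := fun j => by
    simp [W₀, HilbertBasis.repr_self]
  let W : H →L[ℂ] H := W₀.toContinuousLinearMap
  have hW : ∀ j, W (b j) = starRingEnd ℂ (lam (n₀ + j) : ℂ) • b (n₀ + j) := hW₀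
  have hWi : ∀ x y, inner ℂ (W x) (W y) = inner ℂ x y := W₀.inner_map_map
  have hWW : star W * W = 1 := ContinuousLinearMap.ext fun x => ext_inner_left ℂ fun y => by
    rw [mul_apply_eq_comp, ContinuousLinearMap.star_eq_adjoint,
      ContinuousLinearMap.adjoint_inner_right, hWi]
    rfl
  have hlow : ∀ m, m ∉ Set.range (fun j => n₀ + j) → ∀ y, inner ℂ (b m) (W y) = 0 := by
    intro m hm y
    rw [← ContinuousLinearMap.adjoint_inner_left]
    have h0 : ContinuousLinearMap.adjoint W (b m) = 0 := by
      refine b.repr.injective (lp.ext (funext fun i => ?_))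
      rw [b.repr_apply_apply, ContinuousLinearMap.adjoint_inner_right, hW, inner_smul_left,
        b.orthonormal.2 (fun h => hm ⟨i, h⟩)]
      simp
    rw [h0, inner_zero_left]
  -- Cyclicity of the trace for `W`, term by term: `b (n₀ + j)` is a phase times `W (b j)`, and the
  -- phases cancel. By `hlow` the indices below `n₀` contribute nothing.
  have hhigh : ∀ (B : H →L[ℂ] H) j, inner ℂ (b (n₀ + j)) (W (B (b (n₀ + j)))) =
      inner ℂ (b j) (B (W (b j))) := fun B j => by
    have hb : b (n₀ + j) = (lam (n₀ + j) : ℂ) • W (b j) := by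
      rw [hW, smul_smul, mul_comm, hl, one_smul]
    rw [hb, map_smul, map_smul, inner_smul_left, inner_smul_right, hWi, ← mul_assoc, hl, one_mul]
  have hinj : Function.Injective fun j => n₀ + j := add_right_injective n₀
  -- The channel is `T ↦ W T W*`; its adjoint `Ξ` is the compression `A ↦ W* A W`.
  let Θ : (H →L[ℂ] H) →ₗ[ℂ] (H →L[ℂ] H) :=
    LinearMap.mulLeft ℂ W ∘ₗ LinearMap.mulRight ℂ (star W)
  have hmem : ∀ T ∈ traceClass b, Θ T ∈ traceClass b := by
    intro T hT
    refine (Submodule.span_le (p := (traceClass b).comap Θ)).2 ?_ hT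
    rintro T ⟨hT0, hTs⟩
    refine Submodule.subset_span ⟨?_, ?_⟩
    · change 0 ≤ W * (T * star W)
      rw [← mul_assoc]
      exact star_right_conjugate_nonneg hT0 W
    · refine (hinj.summable_iff (f := fun n => inner ℂ (b n) (Θ T (b n)))
        fun m hm => hlow m hm _).1 (hTs.congr fun j => ?_)
      refine ((hhigh (T * star W) j).trans ?_).symm
      rw [mul_apply_eq_comp, ← mul_apply_eq_comp (star W), hWW]
      rfl
  let Ξ : (H →L[ℂ] H) →CP (H →L[ℂ] H) :=
    { LinearMap.mulLeft ℂ (star W) ∘ₗ LinearMap.mulRight ℂ W with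
      map_cstarMatrix_nonneg' := fun k M hM => by
        rw [cstarMatrix_nonneg_iff] at hM ⊢
        intro x
        refine (hM fun i => W (x i)).trans_eq ?_
        refine Finset.sum_congr rfl fun i _ => Finset.sum_congr rfl fun j _ => ?_
        exact (ContinuousLinearMap.adjoint_inner_right W _ _).symm }
  have hΞ : ∀ A, Ξ A = star W * (A * W) := fun A => rfl
  refine (isPreprocessing_iff b _ _).2 ⟨Θ.restrict hmem, Ξ, ?_, fun T A => ?_, fun X hX => ?_⟩
  · rw [hΞ, one_mul, hWW]
  · rw [trace, ← hinj.tsum_eq (fun m hm => by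
      by_contra hm'
      exact hm (hlow m hm' _))]
    refine tsum_congr fun j => ?_
    exact hhigh ((T : H →L[ℂ] H) * star W * A) j
  · refine ext_inner_basis b fun m n => ?_
    rw [hΞ, mul_apply_eq_comp, mul_apply_eq_comp, ContinuousLinearMap.star_eq_adjoint,
      ContinuousLinearMap.adjoint_inner_right, hW, hW, map_smul, inner_smul_left,
      inner_smul_right, hE.inner_effect _ _ X hX, h _ _ (by omega) (by omega),
      (hasPhaseMatrix_canonicalPhase b).inner_effect m n X hX, Matrix.of_apply, one_mul]
    have e : ((n₀ + m : ℕ) : ℤ) - ((n₀ + n : ℕ) : ℤ) = (m : ℤ) - n := by push_cast; ring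
    rw [e, Complex.conj_conj]
    linear_combination (-1 - (starRingEnd ℂ (lam (n₀ + m) : ℂ) * (lam (n₀ + m) : ℂ) - 1)) *
      (∫ t in X, (t : ℂ) ^ ((m : ℤ) - (n : ℤ)) ∂haarCircle) * hl (n₀ + n) -
      (∫ t in X, (t : ℂ) ^ ((m : ℤ) - (n : ℤ)) ∂haarCircle) * hl (n₀ + m)

/-! ### Existence of the phase matrix -/

lemma numberRep_star_apply (b : HilbertBasis ℕ ℂ H) (t : Circle) (n : ℕ) :
    star ((numberRep b t : H ≃L[ℂ] H) : H →L[ℂ] H) (b n) = ((t : ℂ) ^ n)⁻¹ • b n := by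
  have h0 : (t : ℂ) ^ n ≠ 0 := pow_ne_zero _ t.coe_ne_zero
  have h1 : b n = ((numberRep b t : H ≃L[ℂ] H) : H →L[ℂ] H) (((t : ℂ) ^ n)⁻¹ • b n) := by
    rw [map_smul]
    change _ = _ • numberRep b t (b n)
    rw [numberRep_apply, smul_smul, inv_mul_cancel₀ h0, one_smul]
  refine ext_inner_left ℂ fun φ => ?_
  conv_lhs => rw [h1]
  rw [ContinuousLinearMap.star_eq_adjoint, ContinuousLinearMap.adjoint_inner_right]
  exact (numberRep b t).inner_map_map _ _

/-- The left side does not involve `s`, so the right side may be averaged over the torus. -/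
lemma IsPhaseObservable.inner_effect_preimage {b : HilbertBasis ℕ ℂ H} {E : Observable Circle H}
    (hE : IsPhaseObservable b E) (m n : ℕ) (s : Circle) {X : Set Circle} (hX : MeasurableSet X) :
    inner ℂ (b m) (E.effect X (b n)) =
      (s : ℂ) ^ ((m : ℤ) - (n : ℤ)) * inner ℂ (b m) (E.effect ((fun t => s * t) ⁻¹' X) (b n)) := by
  have hs := s.coe_ne_zero
  have h := hE s ((fun t => s * t) ⁻¹' X) (measurable_const_mul s hX)
  rw [Set.image_preimage_eq X (mul_left_surjective s)] at h
  rw [← h, mul_assoc, mul_apply_eq_comp, ← ContinuousLinearMap.adjoint_inner_left,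
    ← ContinuousLinearMap.star_eq_adjoint, numberRep_star_apply, mul_apply_eq_comp,
    numberRep_star_apply, map_smul, inner_smul_left, inner_smul_right, zpow_sub₀ hs, zpow_natCast,
    zpow_natCast, map_inv₀, map_pow, ← Circle.coe_inv_eq_conj, Circle.coe_inv, inv_pow, inv_inv,
    div_eq_mul_inv, mul_assoc]

/-- Averaging the translates of a finite measure on the torus against a character. -/
lemma integral_zpow_mul_measure_preimage (μ : Measure Circle) [IsFiniteMeasure μ] (k : ℤ)
    {X : Set Circle} (hX : MeasurableSet X) :
    Integrable (fun s : Circle => (s : ℂ) ^ k * μ.real ((fun t => s * t) ⁻¹' X)) haarCircle ∧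
    ∫ s : Circle, (s : ℂ) ^ k * μ.real ((fun t => s * t) ⁻¹' X) ∂haarCircle =
      (∫ t : Circle, (t : ℂ) ^ (-k) ∂μ) * ∫ u in X, (u : ℂ) ^ k ∂haarCircle := by
  have hinner : ∀ s : Circle, (s : ℂ) ^ k * μ.real ((fun t => s * t) ⁻¹' X) =
      ∫ t, (s : ℂ) ^ k * X.indicator (fun _ => (1 : ℂ)) (s * t) ∂μ := fun s => by
    rw [integral_const_mul]
    have h1 : (fun t => X.indicator (fun _ => (1 : ℂ)) (s * t)) =
        ((fun t => s * t) ⁻¹' X).indicator fun _ => (1 : ℂ) := rfl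
    rw [h1, integral_indicator (measurable_const_mul s hX)]
    simp
  have hint : Integrable (Function.uncurry fun s t : Circle =>
      (s : ℂ) ^ k * X.indicator (fun _ => (1 : ℂ)) (s * t)) (haarCircle.prod μ) := by
    refine memLp_one_iff_integrable.1 (MemLp.of_bound (Measurable.aestronglyMeasurable ?_) 1
      (Filter.Eventually.of_forall fun p => ?_))
    · exact ((continuous_zpow_circle k).measurable.comp measurable_fst).mul
        ((measurable_const.indicator hX).comp (measurable_fst.mul measurable_snd))
    · rw [Function.uncurry_def, norm_mul, norm_zpow, Circle.norm_coe, one_zpow, one_mul]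
      exact (norm_indicator_le_norm_self _ _).trans (by simp)
  simp only [hinner]
  refine ⟨hint.integral_prod_left, ?_⟩
  -- After Fubini, the substitution `s = t⁻¹ u` splits `sᵏ` into `t⁻ᵏ uᵏ` and separates the
  -- variables.
  rw [integral_integral_swap hint, ← integral_mul_const]
  refine integral_congr_ae (Filter.Eventually.of_forall fun t => ?_)
  dsimp only
  rw [← integral_mul_left_eq_self (μ := haarCircle) _ t⁻¹, ← integral_indicator hX,
    ← integral_const_mul]
  refine integral_congr_ae (Filter.Eventually.of_forall fun u => ?_)
  dsimp only
  have h1 : t⁻¹ * u * t = u := by rw [mul_comm, mul_inv_cancel_left]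
  rw [h1, Circle.coe_mul, Circle.coe_inv, mul_zpow, inv_zpow', mul_assoc]
  by_cases hu : u ∈ X <;> simp [hu]

lemma Observable.inner_effect_polarization {Ω : Type*} [MeasurableSpace Ω] (E : Observable Ω H)
    {X : Set Ω} (hX : MeasurableSet X) (φ ψ : H) :
    inner ℂ φ (E.effect X ψ) =
      ((E.distribution (φ + ψ)).real X - (E.distribution (φ - ψ)).real X -
        Complex.I * (E.distribution (φ + Complex.I • ψ)).real X +
        Complex.I * (E.distribution (φ - Complex.I • ψ)).real X) / 4 := by
  have hsa := IsSelfAdjoint.of_nonneg (E.effect_nonneg X hX)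
  have hs : ∀ φ ψ, inner ℂ (E.effect X φ) ψ = inner ℂ φ (E.effect X ψ) := fun φ ψ => by
    rw [← ContinuousLinearMap.adjoint_inner_right, ← ContinuousLinearMap.star_eq_adjoint,
      hsa.star_eq]
  have h := inner_map_polarization' (E.effect X : H →ₗ[ℂ] H) φ ψ
  simp only [ContinuousLinearMap.coe_coe, hs] at h
  simp only [E.distribution_real _ hX, h]

/-- Averaging `inner_effect_preimage` over `s` gives the formula, with `z` the integral of `t ^ (n -
m)` against the complex measure `⟨m|E(·)|n⟩`. Polarization writes this measure through four positive
ones, to which the averaging lemma applies. -/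
lemma IsPhaseObservable.exists_inner_effect_eq {b : HilbertBasis ℕ ℂ H} {E : Observable Circle H}
    (hE : IsPhaseObservable b E) (m n : ℕ) :
    ∃ z : ℂ, ∀ X, MeasurableSet X → inner ℂ (b m) (E.effect X (b n)) =
      z * ∫ t in X, (t : ℂ) ^ ((m : ℤ) - (n : ℤ)) ∂haarCircle := by
  set k : ℤ := (m : ℤ) - (n : ℤ)
  let J : H → ℂ := fun φ => ∫ t : Circle, (t : ℂ) ^ (-k) ∂(E.distribution φ)
  refine ⟨(J (b m + b n) - J (b m - b n) - Complex.I * J (b m + Complex.I • b n) +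
    Complex.I * J (b m - Complex.I • b n)) / 4, fun X hX => ?_⟩
  have hF := fun φ : H => integral_zpow_mul_measure_preimage (E.distribution φ) k hX
  have h1 : inner ℂ (b m) (E.effect X (b n)) = ∫ s : Circle,
      (s : ℂ) ^ k * inner ℂ (b m) (E.effect ((fun t => s * t) ⁻¹' X) (b n)) ∂haarCircle := by
    simp only [k, ← hE.inner_effect_preimage m n _ hX]
    simp
  have h2 : ∀ s : Circle,
      (s : ℂ) ^ k * inner ℂ (b m) (E.effect ((fun t => s * t) ⁻¹' X) (b n)) =
      4⁻¹ * ((s : ℂ) ^ k * (E.distribution (b m + b n)).real ((fun t => s * t) ⁻¹' X) -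
        (s : ℂ) ^ k * (E.distribution (b m - b n)).real ((fun t => s * t) ⁻¹' X) -
        Complex.I * ((s : ℂ) ^ k *
          (E.distribution (b m + Complex.I • b n)).real ((fun t => s * t) ⁻¹' X)) +
        Complex.I * ((s : ℂ) ^ k *
          (E.distribution (b m - Complex.I • b n)).real ((fun t => s * t) ⁻¹' X))) := fun s => by
    rw [E.inner_effect_polarization (measurable_const_mul s hX)]
    ring
  simp only [h2] at h1
  have hlin : ∀ f₁ f₂ f₃ f₄ : Circle → ℂ, Integrable f₁ haarCircle → Integrable f₂ haarCircle →
      Integrable f₃ haarCircle → Integrable f₄ haarCircle →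
      ∫ s, 4⁻¹ * (f₁ s - f₂ s - Complex.I * f₃ s + Complex.I * f₄ s) ∂haarCircle =
        4⁻¹ * (∫ s, f₁ s ∂haarCircle - ∫ s, f₂ s ∂haarCircle - Complex.I * ∫ s, f₃ s ∂haarCircle +
          Complex.I * ∫ s, f₄ s ∂haarCircle) := fun f₁ f₂ f₃ f₄ i₁ i₂ i₃ i₄ => by
    rw [integral_const_mul,
      integral_add (f := fun s => f₁ s - f₂ s - Complex.I * f₃ s) (g := fun s => Complex.I * f₄ s)
        ((i₁.sub i₂).sub (i₃.const_mul _)) (i₄.const_mul _),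
      integral_sub (f := fun s => f₁ s - f₂ s) (g := fun s => Complex.I * f₃ s)
        (i₁.sub i₂) (i₃.const_mul _),
      integral_sub i₁ i₂, integral_const_mul, integral_const_mul]
  refine (h1.trans (hlin _ _ _ _ (hF _).1 (hF _).1 (hF _).1 (hF _).1)).trans ?_
  rw [(hF _).2, (hF _).2, (hF _).2, (hF _).2]
  ring

instance : haarCircle.IsHaarMeasure := Measure.isHaarMeasure_haarMeasure ⊤

open Filter Topology in
/-- Every phase observable has a phase matrix. -/
lemma IsPhaseObservable.exists_hasPhaseMatrix {b : HilbertBasis ℕ ℂ H} {E : Observable Circle H}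
    (hE : IsPhaseObservable b E) : ∃ c : Matrix ℕ ℕ ℂ, HasPhaseMatrix b E c := by
  choose c hc using hE.exists_inner_effect_eq
  -- On balls shrinking to `1` the characters tend to `1`, so the entries of `E(X j)` divided by the
  -- Haar measure of `X j` tend to `c`. Hermitian symmetry and positivity pass to the limit.
  let X : ℕ → Set Circle := fun j => Metric.ball 1 (1 / ((j : ℝ) + 1))
  have hX : ∀ j, MeasurableSet (X j) := fun j => measurableSet_ball
  have hpos : ∀ j, 0 < haarCircle.real (X j) := fun j =>
    ENNReal.toReal_pos (Metric.isOpen_ball.measure_pos _ ⟨1, by simp; positivity⟩).ne'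
      (measure_ne_top _ _)
  let q : ℕ → ℕ → ℕ → ℂ := fun j m n =>
    ((haarCircle.real (X j) : ℝ) : ℂ)⁻¹ * inner ℂ (b m) (E.effect (X j) (b n))
  have hq : ∀ m n, Tendsto (fun j => q j m n) atTop (𝓝 (c m n)) := fun m n => by
    have h1 : Tendsto (fun j => ((haarCircle.real (X j) : ℝ) : ℂ)⁻¹ *
        ∫ t in X j, (t : ℂ) ^ ((m : ℤ) - (n : ℤ)) ∂haarCircle) atTop (𝓝 1) := by
      refine Metric.tendsto_atTop.2 fun ε hε => ?_
      obtain ⟨δ, hδ, h⟩ := Metric.continuous_iff.1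
        (continuous_zpow_circle ((m : ℤ) - (n : ℤ))) 1 (ε / 2) (half_pos hε)
      obtain ⟨N, hN⟩ := exists_nat_one_div_lt hδ
      refine ⟨N, fun j hj => ?_⟩
      have hh : ((haarCircle.real (X j) : ℝ) : ℂ) ≠ 0 := by exact_mod_cast (hpos j).ne'
      have e : ((haarCircle.real (X j) : ℝ) : ℂ)⁻¹ *
          (∫ t in X j, (t : ℂ) ^ ((m : ℤ) - (n : ℤ)) ∂haarCircle) - 1 =
          ((haarCircle.real (X j) : ℝ) : ℂ)⁻¹ *
          ∫ t in X j, ((t : ℂ) ^ ((m : ℤ) - (n : ℤ)) - 1) ∂haarCircle := by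
        rw [integral_sub (integrable_zpow_circle _ _) (integrable_const _), mul_sub]
        simp [hh]
      rw [dist_eq_norm, e, norm_mul, norm_inv, Complex.norm_real,
        Real.norm_of_nonneg (hpos j).le, inv_mul_lt_iff₀ (hpos j)]
      refine (norm_setIntegral_le_of_norm_le_const (C := ε / 2) (measure_lt_top _ _)
        fun t ht => ?_).trans_lt ?_
      · have h2 := h t ((Metric.mem_ball.1 ht).trans_le
          ((Nat.one_div_le_one_div hj).trans hN.le))
        rw [dist_eq_norm] at h2
        simpa using h2.le
      · rw [mul_comm]
        exact mul_lt_mul_of_pos_left (half_lt_self hε) (hpos j)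
    have h2 := h1.const_mul (c m n)
    rw [mul_one] at h2
    refine h2.congr fun j => ?_
    simp only [q, hc m n _ (hX j)]
    ring
  have hsa : ∀ j m n, starRingEnd ℂ (q j m n) = q j n m := fun j m n => by
    have hs := (IsSelfAdjoint.of_nonneg (E.effect_nonneg _ (hX j))).star_eq
    simp only [q]
    rw [map_mul, map_inv₀, Complex.conj_ofReal, inner_conj_symm,
      ← ContinuousLinearMap.adjoint_inner_right, ← ContinuousLinearMap.star_eq_adjoint, hs]
  refine ⟨c, ⟨?_, fun x => ?_⟩, fun n => ?_, hc⟩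
  · ext m n
    change star (c n m) = c m n
    refine tendsto_nhds_unique ((hq n m).star) ((hq m n).congr fun j => ?_)
    exact (hsa j n m).symm
  · have ht : Tendsto (fun j => x.sum fun m xm => x.sum fun n xn => star xm * q j m n * xn) atTop
        (𝓝 (x.sum fun m xm => x.sum fun n xn => star xm * c m n * xn)) :=
      tendsto_finsetSum _ fun m _ => tendsto_finsetSum _ fun n _ =>
        ((hq m n).const_mul _).mul_const _
    refine ge_of_tendsto' ht fun j => ?_
    have h0 := (nonneg_iff_inner _).1 (E.effect_nonneg _ (hX j)) (x.sum fun n xn => xn • b n)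
    have h1 : (0 : ℂ) ≤ ((haarCircle.real (X j) : ℝ) : ℂ)⁻¹ := by
      rw [← Complex.ofReal_inv]
      exact Complex.zero_le_real.2 (inv_nonneg.2 (hpos j).le)
    refine (mul_nonneg h1 h0).trans_eq ?_
    simp only [Finsupp.sum, map_sum, sum_inner, inner_sum, map_smul, inner_smul_left,
      inner_smul_right, Finset.mul_sum, q]
    rw [Finset.sum_comm]
    refine Finset.sum_congr rfl fun m _ => Finset.sum_congr rfl fun n _ => ?_
    rw [Complex.star_def]
    ring
  · have h := hc n n Set.univ .univ
    rw [E.effect_univ] at h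
    simpa [inner_self_eq_norm_sq_to_K, b.orthonormal.1 n] using h.symm

end QuantumPhase

/-! ### The characterizations of equivalence and cleanness -/

theorem mainTheorem1 {H : Type*} [NormedAddCommGroup H] [InnerProductSpace ℂ H] [CompleteSpace H]
    (b : HilbertBasis ℕ ℂ H) :
    (∀ (E : QuantumPhase.Observable Circle H) (c : Matrix ℕ ℕ ℂ),
      QuantumPhase.IsPhaseObservable b E → QuantumPhase.HasPhaseMatrix b E c →
        (QuantumPhase.PreprocessingEquiv b E (QuantumPhase.canonicalPhase b) ↔
          ∃ (n₀ : ℕ) (lam : ℕ → Circle), ∀ m n : ℕ, n₀ ≤ m → n₀ ≤ n →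
            c m n = (starRingEnd ℂ) (lam m : ℂ) * (lam n : ℂ))) ∧
    (∀ E : QuantumPhase.Observable Circle H, QuantumPhase.IsPhaseObservable b E →
      (QuantumPhase.IsPreprocessingClean b E ↔
        ∃ c : Matrix ℕ ℕ ℂ, QuantumPhase.HasPhaseMatrix b E c ∧
          ∃ (n₀ : ℕ) (lam : ℕ → Circle), ∀ m n : ℕ, n₀ ≤ m → n₀ ≤ n →
            c m n = (starRingEnd ℂ) (lam m : ℂ) * (lam n : ℂ))) := by
  have ha : ∀ (E : QuantumPhase.Observable Circle H) (c : Matrix ℕ ℕ ℂ),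
      QuantumPhase.HasPhaseMatrix b E c →
        (QuantumPhase.PreprocessingEquiv b E (QuantumPhase.canonicalPhase b) ↔
          ∃ (n₀ : ℕ) (lam : ℕ → Circle), ∀ m n : ℕ, n₀ ≤ m → n₀ ≤ n →
            c m n = (starRingEnd ℂ) (lam m : ℂ) * (lam n : ℂ)) := fun E c hc => by
    constructor
    · rintro ⟨-, h⟩
      obtain ⟨n₀, hn⟩ := QuantumPhase.exists_norm_eq_one_of_isPreprocessing b hc h
      exact ⟨n₀, QuantumPhase.exists_phases hc.posSemidef hc.diag hn⟩
    · rintro ⟨n₀, lam, h⟩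
      exact ⟨QuantumPhase.hasPhaseMatrix_isPreprocessing_canonicalPhase b hc,
        QuantumPhase.isPreprocessing_canonicalPhase_of_phases b hc h⟩
  refine ⟨fun E c _ hc => ha E c hc, fun E hE => ⟨fun h => ?_, ?_⟩⟩
  -- Cleanness is tested against the canonical observable, which lies above `E`.
  · obtain ⟨c, hc⟩ := hE.exists_hasPhaseMatrix
    exact ⟨c, hc, (ha E c hc).1 (h _ (QuantumPhase.isPhaseObservable_canonicalPhase b)
      (QuantumPhase.hasPhaseMatrix_isPreprocessing_canonicalPhase b hc))⟩
  -- Any `F` is below the canonical observable, which by (a) is below `E`.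
  · rintro ⟨c, hc, hlam⟩ F hF hEF
    obtain ⟨d, hd⟩ := hF.exists_hasPhaseMatrix
    exact ⟨hEF, (QuantumPhase.hasPhaseMatrix_isPreprocessing_canonicalPhase b hd).trans
      ((ha E c hc).2 hlam).2⟩
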